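/- Let $A$ be a unital $\mathrm{C}^*$-algebra. Let $U^\infty(A)=\varinjlim_n U(M_n(A))$ be its infinite unitary group, the limit being taken along $u\mapsto\operatorname{diag}(u,1)$, with the inductive limit topology. Let $U_0^\infty(A)$ be the subgroup of the unitaries that are connected to $1$ by a path in some $U(M_n(A))$, and let $DU^\infty(A)$ be the commutator subgroup of $U^\infty(A)$. Put $$\overline{\mathrm K}_1(A):=U^\infty(A)/\overline{DU^\infty(A)},\qquad \mathrm K_1(A):=U^\infty(A)/\overline{U^\infty_0(A)},$$ let $\overline u\in\overline{\mathrm K}_1(A)$ and $[u]\in\mathrm K_1(A)$ be the classes of $u\in U^\infty(A)$, and let $\pi_A\colon\overline{\mathrm K}_1(A)\to\mathrm K_1(A)$, $\overline u\mapsto[u]$, be the quotient map (both groups are abelian and are written additively). Let $\operatorname{Tr}\colon A\to A/\overline{[A,A]}$ be the universal trace, extended to matrices by $\operatorname{Tr}(x)=\operatorname{Tr}(\sum_i x_{ii})$, let $A_0=\{h\in A_{\mathrm{sa}}:\operatorname{Tr}(h)=0\}$, so that $A_{\mathrm{sa}}/A_0\simeq\operatorname{Aff}T_1(A)$, and let $\overline{\mathrm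 K_0(A)}$ be the closure in $A_{\mathrm{sa}}/A_0$ of the subgroup generated by the elements $\operatorname{Tr}(p)$, $p$ a projection in some $M_n(A)$. Put $\mathrm H(A):=(A_{\mathrm{sa}}/A_0)/\overline{\mathrm K_0(A)}$ and let $i_A\colon\mathrm H(A)\to\overline{\mathrm K}_1(A)$ be $[h]\mapsto\overline{\exp(2\pi i h)}$; it is the inclusion of $U_0^\infty(A)/\overline{DU^\infty(A)}$ composed with the inverse of the isomorphism $U_0^\infty(A)/\overline{DU^\infty(A)}\simeq\mathrm H(A)$ given by the non-stable de la Harpe–Skandalis determinant $\overline\Delta$. The Nielsen–Thomsen sequence of $A$ is $$0\longrightarrow \mathrm H(A)\xrightarrow{\ i_A\ }\overline{\mathrm K}_1(A)\xrightarrow{\ \pi_A\ }\mathrm K_1(A)\longrightarrow0 .$$ A section (of $\pi_A$) is a group morphism $s_A$ with $\pi_A s_A=\mathrm{id}$, and a retract (of $i_A$) is a group morphism $r_A$ with $r_A i_A=\mathrm{id}$. A Nielsen–Thomsen basis of $A$ is a family $\mathcal C=(c_k)_{k\in\mathrm K_1(A)}$ in $U^\infty(A)$ with $c_0=1$ such that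 $k\mapsto\overline{c_k}$ is a group morphism and a section of $\pi_A$. It induces the group isomorphism $\nu_{\mathcal C}\colon\overline{\mathrm K}_1(A)\to\mathrm H(A)\oplus\mathrm K_1(A)$, $\overline u\mapsto(\overline\Delta(\operatorname{diag}(u,c_{[u]}^*)),[u])$; in other words $\nu_{\mathcal C}(\overline u)=(x,[u])$ with $i_A(x)=\overline u-\overline{c_{[u]}}$. A group morphism $\beta\colon\overline{\mathrm K}_1(A)\to\overline{\mathrm K}_1(B)$ is Nielsen–Thomsen diagonalisable if there are Nielsen–Thomsen bases $\mathcal C$ of $A$ and $\mathcal D$ of $B$ such that the matrix $\nu_{\mathcal D}\,\beta\,\nu_{\mathcal C}^{-1}\colon \mathrm H(A)\oplus\mathrm K_1(A)\to\mathrm H(B)\oplus\mathrm K_1(B)$ is diagonal. A $*$-homomorphism $\phi\colon A\to B$, not necessarily unital, induces a morphism $(\mathrm H(\phi),\overline{\mathrm K}_1(\phi),\mathrm K_1(\phi))$ of Nielsen–Thomsen sequences, by $[h]\mapsto[\phi(h)]$ on $\mathrm H$ and by $u\mapsto\phi(u)+1-\phi(1)$ on unitaries of matrices. This triple is called split if there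 are splittings of the two sequences, that is, isomorphisms $\nu_A\colon\overline{\mathrm K}_1(A)\to\mathrm H(A)\oplus\mathrm K_1(A)$ and $\nu_B\colon\overline{\mathrm K}_1(B)\to\mathrm H(B)\oplus\mathrm K_1(B)$ that carry $i$ and $\pi$ to the canonical inclusion and projection, such that $\nu_B\,\overline{\mathrm K}_1(\phi)\,\nu_A^{-1}=\mathrm H(\phi)\oplus\mathrm K_1(\phi)$. **Statement.** Let $A,B$ be unital $\mathrm C^*$-algebras and let $\beta\colon\overline{\mathrm K}_1(A)\to\overline{\mathrm K}_1(B)$ be a group morphism. The following are equivalent. (i) $\beta$ is Nielsen–Thomsen diagonalisable. (ii) There exist a section $s_A\colon\mathrm K_1(A)\to\overline{\mathrm K}_1(A)$ of $\pi_A$ and a retract $r_B\colon\overline{\mathrm K}_1(B)\to\mathrm H(B)$ of $i_B$ such that $r_B\circ\beta\circ s_A=0$ and $\operatorname{im}(\beta\circ i_A)\subseteq\operatorname{im}(i_B)$. If moreover $\beta=\overline{\mathrm K}_1(\phi)$ for some $*$-homomorphism $\phi\colon A\to B$, then these are also equivalent to each of the following. (iii) The triple $(\mathrm H(\phi),\overline{\mathrm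 K}_1(\phi),\mathrm K_1(\phi))$ between the Nielsen–Thomsen sequences of $A$ and $B$ is split. (iv) There exist sections $s_A,s_B$ of $\pi_A,\pi_B$ such that $\overline{\mathrm K}_1(\phi)\circ s_A=s_B\circ\mathrm K_1(\phi)$. -/

import Mathlib

namespace NielsenThomsen

noncomputable section

attribute [local instance] CStarAlgebra.spectralOrder CStarAlgebra.spectralOrderedRing

/-- The matrix algebra `M_n(A)` over a unital C⋆-algebra, again a unital C⋆-algebra. -/
def Mat (n : ℕ) (A : Type*) : Type _ := CStarMatrix (Fin n) (Fin n) A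

instance (n : ℕ) (A : Type*) [CStarAlgebra A] : CStarAlgebra (Mat n A) :=
  inferInstanceAs (CStarAlgebra (CStarMatrix (Fin n) (Fin n) A))

/-- The identification of the matrices over `A` with the elements of the C⋆-algebra `M_n(A)`. -/
def matEquiv (n : ℕ) (A : Type*) [CStarAlgebra A] : Matrix (Fin n) (Fin n) A ≃⋆ₐ[ℂ] Mat n A :=
  CStarMatrix.ofMatrixStarAlgEquiv (n := Fin n) (A := A)

/-- The matrix of an element of the C⋆-algebra `M_n(A)`. -/
def entries {n : ℕ} {A : Type*} [CStarAlgebra A] (x : Mat n A) : Matrix (Fin n) (Fin n) A :=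
  (matEquiv n A).symm x

lemma entries_matEquiv {n : ℕ} {A : Type*} [CStarAlgebra A] (x : Matrix (Fin n) (Fin n) A) :
    entries (matEquiv n A x) = x := (matEquiv n A).symm_apply_apply x

lemma matEquiv_entries {n : ℕ} {A : Type*} [CStarAlgebra A] (x : Mat n A) :
    matEquiv n A (entries x) = x := (matEquiv n A).apply_symm_apply x

lemma entries_injective {n : ℕ} {A : Type*} [CStarAlgebra A] :
    Function.Injective (entries (n := n) (A := A)) := (matEquiv n A).symm.injective

/-- A ⋆-homomorphism applied entrywise to matrices. -/
def matMap {A B : Type*} [CStarAlgebra A] [CStarAlgebra B] (φ : A →⋆ₙₐ[ℂ] B) (n : ℕ) :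
    Mat n A →⋆ₙₐ[ℂ] Mat n B where
  toFun x := matEquiv n B ((entries x).map φ)
  map_smul' c x := by
    rw [MonoidHom.id_apply, ← map_smul]
    refine congrArg _ ?_
    ext i j
    simp [entries]
  map_zero' := by
    rw [← map_zero (matEquiv n B)]
    refine congrArg _ ?_
    ext i j
    simp [entries]
  map_add' x y := by
    rw [← map_add]
    refine congrArg _ ?_
    ext i j
    simp [entries]
  map_mul' x y := by
    rw [← map_mul]
    refine congrArg _ ?_
    ext i j
    simp [entries, Matrix.mul_apply]
  map_star' x := by
    rw [← map_star]
    refine congrArg _ ?_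
    ext i j
    simp [entries, Matrix.star_apply, map_star]

lemma entries_matMap {A B : Type*} [CStarAlgebra A] [CStarAlgebra B] (φ : A →⋆ₙₐ[ℂ] B) {n : ℕ}
    (x : Mat n A) : entries (matMap φ n x) = (entries x).map φ := entries_matEquiv _

section UnitaryExtend

variable {R S T : Type*} [CStarAlgebra R] [CStarAlgebra S] [CStarAlgebra T]

/-- A (not necessarily unital) ⋆-homomorphism `f` acts on unitaries by `u ↦ f(u) + (1 - f(1))`. -/
def unitaryExtend (f : R →⋆ₙₐ[ℂ] S) : unitary R →* unitary S where
  toFun u := ⟨f u + (1 - f 1), by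
    have h1 : f (u : R) * f 1 = f u := by rw [← map_mul, mul_one]
    have h2 : f 1 * f (u : R) = f u := by rw [← map_mul, one_mul]
    have h3 : f (star (u : R)) * f 1 = f (star (u : R)) := by rw [← map_mul, mul_one]
    have h4 : f 1 * f (star (u : R)) = f (star (u : R)) := by rw [← map_mul, one_mul]
    have h5 : f 1 * f 1 = f 1 := by rw [← map_mul, one_mul]
    have h6 : f (u : R) * f (star (u : R)) = f 1 := by rw [← map_mul]; simp
    have h7 : f (star (u : R)) * f (u : R) = f 1 := by rw [← map_mul]; simp
    have h8 : star (f (1 : R)) = f 1 := by rw [← map_star, star_one]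
    rw [Unitary.mem_iff]
    simp only [star_add, star_sub, star_one, h8, ← map_star]
    constructor <;> simp only [mul_add, add_mul, mul_sub, sub_mul, mul_one, one_mul, *] <;> abel⟩
  map_one' := by ext; simp
  map_mul' u v := by
    ext
    have h1 : f (u : R) * f 1 = f u := by rw [← map_mul, mul_one]
    have h2 : f 1 * f (v : R) = f v := by rw [← map_mul, one_mul]
    have h5 : f 1 * f 1 = f 1 := by rw [← map_mul, one_mul]
    simp only [Submonoid.coe_mul, map_mul, mul_add, add_mul, mul_sub, sub_mul, mul_one, one_mul, *]
    abel

@[simp] lemma coe_unitaryExtend (f : R →⋆ₙₐ[ℂ] S) (u : unitary R) :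
    (unitaryExtend f u : S) = f u + (1 - f 1) := rfl

lemma unitaryExtend_comp (g : S →⋆ₙₐ[ℂ] T) (f : R →⋆ₙₐ[ℂ] S) (u : unitary R) :
    unitaryExtend g (unitaryExtend f u) = unitaryExtend (g.comp f) u := by
  ext; simp [add_assoc]

lemma continuous_hom (f : R →⋆ₙₐ[ℂ] S) : Continuous f :=
  haveI := NonUnitalStarAlgHom.instContinuousLinearMapClassComplex (F := R →⋆ₙₐ[ℂ] S)
  map_continuous f

lemma continuous_unitaryExtend (f : R →⋆ₙₐ[ℂ] S) : Continuous (unitaryExtend f) :=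
  Continuous.subtype_mk (((continuous_hom f).comp continuous_subtype_val).add continuous_const) _

end UnitaryExtend

section Corner

open scoped Matrix

variable (A : Type*) [CStarAlgebra A] {k n m : ℕ}

/-- The rectangular matrix whose `j`-th column is the `g j`-th standard basis vector. -/
def isom (g : Fin n ↪ Fin m) : Matrix (Fin m) (Fin n) A :=
  (1 : Matrix (Fin m) (Fin m) A).submatrix id g

variable {A}

lemma isom_apply (g : Fin n ↪ Fin m) (i : Fin m) (j : Fin n) :
    isom A g i j = if i = g j then 1 else 0 := by
  simp [isom, Matrix.one_apply]

lemma isom_conj_mul (g : Fin n ↪ Fin m) : (isom A g)ᴴ * isom A g = 1 := by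
  ext i j
  simp [Matrix.mul_apply, Matrix.conjTranspose_apply, isom_apply, Matrix.one_apply, apply_ite star,
    g.injective.eq_iff, eq_comm]

lemma isom_mul (f : Fin n ↪ Fin m) (g : Fin k ↪ Fin n) :
    isom A f * isom A g = isom A (g.trans f) := by
  ext i j
  simp [Matrix.mul_apply, isom_apply]

/-- The map `x ↦ V x V⋆` for the isometry `V = isom A g`. -/
def cornerMatrix (g : Fin n ↪ Fin m) :
    Matrix (Fin n) (Fin n) A →⋆ₙₐ[ℂ] Matrix (Fin m) (Fin m) A where
  toFun x := isom A g * x * (isom A g)ᴴ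
  map_smul' c x := by simp
  map_zero' := by simp
  map_add' x y := by rw [Matrix.mul_add, Matrix.add_mul]
  map_mul' x y := by
    rw [Matrix.mul_assoc (isom A g * x), ← Matrix.mul_assoc (isom A g)ᴴ,
      ← Matrix.mul_assoc (isom A g)ᴴ, isom_conj_mul, Matrix.one_mul]
    simp only [Matrix.mul_assoc]
  map_star' x := by
    simp [Matrix.star_eq_conjTranspose, Matrix.conjTranspose_mul, Matrix.mul_assoc]

/-- The embedding of `M_n(A)` into `M_m(A)` as the corner on the rows and columns in the image
of `g`, all other entries being `0`. -/
def corner (g : Fin n ↪ Fin m) : Mat n A →⋆ₙₐ[ℂ] Mat m A :=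
  ((matEquiv m A : Matrix (Fin m) (Fin m) A →⋆ₙₐ[ℂ] Mat m A).comp (cornerMatrix g)).comp
    ((matEquiv n A).symm : Mat n A →⋆ₙₐ[ℂ] Matrix (Fin n) (Fin n) A)

lemma corner_def (g : Fin n ↪ Fin m) (x : Mat n A) :
    corner g x = matEquiv m A (isom A g * entries x * (isom A g)ᴴ) := rfl

lemma corner_apply_apply (g : Fin n ↪ Fin m) (x : Mat n A) (i j : Fin n) :
    entries (corner g x) (g i) (g j) = entries x i j := by
  rw [corner_def, entries_matEquiv]
  simp [Matrix.mul_apply, isom_apply, apply_ite star, g.injective.eq_iff]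

lemma corner_apply_of_notMem (g : Fin n ↪ Fin m) (x : Mat n A) {i j : Fin m}
    (h : i ∉ Set.range g ∨ j ∉ Set.range g) : entries (corner g x) i j = 0 := by
  rw [corner_def, entries_matEquiv]
  simp only [Matrix.mul_apply, isom_apply, Matrix.conjTranspose_apply, apply_ite star, star_one,
    star_zero]
  rcases h with h | h
  · have : ∀ l, i ≠ g l := fun l hl => h ⟨l, hl.symm⟩
    simp [this]
  · have : ∀ l, j ≠ g l := fun l hl => h ⟨l, hl.symm⟩
    simp [this]

lemma corner_corner (f : Fin n ↪ Fin m) (g : Fin k ↪ Fin n) (x : Mat k A) :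
    corner f (corner g x) = corner (g.trans f) x := by
  rw [corner_def, corner_def, corner_def, ← isom_mul, Matrix.conjTranspose_mul, entries_matEquiv]
  simp only [Matrix.mul_assoc]

lemma corner_refl (x : Mat n A) : corner (Function.Embedding.refl _) x = x := by
  refine entries_injective ?_
  ext i j
  exact corner_apply_apply (Function.Embedding.refl _) x i j

lemma corner_map {B : Type*} [CStarAlgebra B] (φ : A →⋆ₙₐ[ℂ] B) (g : Fin n ↪ Fin m) (x : Mat n A) :
    corner g (matMap φ n x) = matMap φ m (corner g x) := by
  refine entries_injective ?_
  rw [entries_matMap]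
  ext i j
  rw [Matrix.map_apply]
  by_cases hi : i ∈ Set.range g
  · by_cases hj : j ∈ Set.range g
    · obtain ⟨i, rfl⟩ := hi
      obtain ⟨j, rfl⟩ := hj
      rw [corner_apply_apply, corner_apply_apply, entries_matMap, Matrix.map_apply]
    · rw [corner_apply_of_notMem _ _ (Or.inr hj), corner_apply_of_notMem _ _ (Or.inr hj), map_zero]
  · rw [corner_apply_of_notMem _ _ (Or.inl hi), corner_apply_of_notMem _ _ (Or.inl hi), map_zero]

end Corner

section UInf

variable (A : Type*) [CStarAlgebra A]

/-- The stabilisation map `U_n(A) → U_m(A)`, `u ↦ diag(u, 1)`, for `n ≤ m`. -/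
def stab (n m : ℕ) (h : n ≤ m) : unitary (Mat n A) →* unitary (Mat m A) :=
  unitaryExtend (corner (Fin.castLEEmb h))

instance : DirectedSystem (fun n => unitary (Mat n A)) (stab A · · ·) where
  map_self n x := by
    ext : 1
    have : Fin.castLEEmb (le_refl n) = Function.Embedding.refl _ := by ext; simp
    simp [stab, this, corner_refl]
  map_map k j i hij hjk x := by
    have : (Fin.castLEEmb hij).trans (Fin.castLEEmb hjk) = Fin.castLEEmb (hij.trans hjk) := by
      ext; simp
    rw [stab, stab, stab, unitaryExtend_comp]
    refine congrArg (fun f => unitaryExtend f x) ?_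
    refine DFunLike.ext _ _ fun y => ?_
    rw [NonUnitalStarAlgHom.comp_apply, corner_corner, this]

/-- The infinite unitary group `U^∞(A) = lim U_n(A)` along `u ↦ diag(u, 1)`. Its topology is the
inductive limit topology, that is, the quotient topology of the disjoint union of the `U_n(A)`. -/
def UInf : Type _ := DirectLimit (fun n => unitary (Mat n A)) (stab A)

instance : Group (UInf A) :=
  inferInstanceAs (Group (DirectLimit (fun n => unitary (Mat n A)) (stab A)))

instance : TopologicalSpace (UInf A) :=
  inferInstanceAs (TopologicalSpace (DirectLimit (fun n => unitary (Mat n A)) (stab A)))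

variable {A}

/-- The canonical map `U_n(A) → U^∞(A)`. -/
def toUInf (n : ℕ) : unitary (Mat n A) →* UInf A where
  toFun u := (⟦⟨n, u⟩⟧ : DirectLimit (fun n => unitary (Mat n A)) (stab A))
  map_one' := (DirectLimit.one_def (f := stab A) n).symm
  map_mul' x y := (DirectLimit.mul_def (f := stab A) n x y).symm

lemma toUInf_stab {n m : ℕ} (h : n ≤ m) (u : unitary (Mat n A)) :
    toUInf m (stab A n m h u) = toUInf n u := by
  exact Quotient.sound ⟨m, le_rfl, h, DirectedSystem.map_self' (stab A) _⟩

lemma exists_toUInf (x : UInf A) : ∃ n u, x = toUInf n u :=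
  DirectLimit.exists_eq_mk (f := stab A) x

lemma exists_toUInf₂ (x y : UInf A) : ∃ n u v, x = toUInf n u ∧ y = toUInf n v :=
  DirectLimit.exists_eq_mk₂ (stab A) x y

lemma continuous_toUInf (n : ℕ) : Continuous (toUInf (A := A) n) :=
  continuous_quotient_mk'.comp (continuous_sigmaMk (σ := fun n => unitary (Mat n A)))

lemma continuous_uInf_iff {X : Type*} [TopologicalSpace X] (f : UInf A → X) :
    Continuous f ↔ ∀ n, Continuous fun u => f (toUInf n u) := by
  refine (isQuotientMap_quotient_mk' (s := DirectLimit.setoid (stab A))).continuous_iff.trans ?_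
  rw [continuous_sigma_iff]
  rfl

lemma continuous_stab {n m : ℕ} (h : n ≤ m) : Continuous (stab A n m h) :=
  continuous_unitaryExtend _

instance : SeparatelyContinuousMul (UInf A) where
  continuous_const_mul {a} := by
    obtain ⟨m, v, rfl⟩ := exists_toUInf a
    refine (continuous_uInf_iff _).2 fun n => ?_
    have : (fun u => toUInf m v * toUInf n u) = fun u : unitary (Mat n A) => toUInf (max m n)
        (stab A m _ (le_max_left m n) v * stab A n _ (le_max_right m n) u) := by
      funext u; rw [map_mul, toUInf_stab, toUInf_stab]
    rw [this]
    exact (continuous_toUInf _).comp (continuous_const.mul (continuous_stab _))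
  continuous_mul_const {a} := by
    obtain ⟨m, v, rfl⟩ := exists_toUInf a
    refine (continuous_uInf_iff _).2 fun n => ?_
    have : (fun u => toUInf n u * toUInf m v) = fun u : unitary (Mat n A) => toUInf (max m n)
        (stab A n _ (le_max_right m n) u * stab A m _ (le_max_left m n) v) := by
      funext u; rw [map_mul, toUInf_stab, toUInf_stab]
    rw [this]
    exact (continuous_toUInf _).comp ((continuous_stab _).mul continuous_const)

instance : ContinuousInv (UInf A) where
  continuous_inv := (continuous_uInf_iff _).2 fun n => by
    simp only [← map_inv]
    exact (continuous_toUInf _).comp continuous_inv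

/-- The closure of a subgroup of `U^∞(A)`. -/
def closureSubgroup (N : Subgroup (UInf A)) : Subgroup (UInf A) where
  toSubmonoid := N.toSubmonoid.topologicalClosure
  inv_mem' hx := map_mem_closure continuous_inv hx fun _ h => N.inv_mem h

lemma coe_closureSubgroup (N : Subgroup (UInf A)) :
    (closureSubgroup N : Set (UInf A)) = closure (N : Set (UInf A)) := rfl

lemma le_closureSubgroup (N : Subgroup (UInf A)) : N ≤ closureSubgroup N :=
  fun _ h => subset_closure h

lemma closureSubgroup_mono {N M : Subgroup (UInf A)} (h : N ≤ M) :
    closureSubgroup N ≤ closureSubgroup M := closure_mono h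

end UInf

section Whitehead

open scoped Matrix

variable {A : Type*} [CStarAlgebra A]

/-- The inclusion of the first `n` coordinates. -/
def isomL (A : Type*) [CStarAlgebra A] (n : ℕ) : Matrix (Fin (n + n)) (Fin n) A :=
  isom A (Fin.castAddEmb n)

/-- The inclusion of the last `n` coordinates. -/
def isomR (A : Type*) [CStarAlgebra A] (n : ℕ) : Matrix (Fin (n + n)) (Fin n) A :=
  isom A (Fin.natAddEmb n)

lemma castAdd_ne_addNat {n : ℕ} (i j : Fin n) : Fin.castAdd n i ≠ Fin.addNat j n := fun h => by
  have := congrArg Fin.val h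
  simp at this
  omega

lemma isomL_isomR (n : ℕ) : (isomL A n)ᴴ * isomR A n = 0 := by
  ext i j
  simp [Matrix.mul_apply, isomL, isomR, isom_apply, (castAdd_ne_addNat _ _).symm]

lemma isomR_isomL (n : ℕ) : (isomR A n)ᴴ * isomL A n = 0 := by
  have := congrArg Matrix.conjTranspose (isomL_isomR (A := A) n)
  simpa [Matrix.conjTranspose_mul] using this

lemma isomL_isomL (n : ℕ) : (isomL A n)ᴴ * isomL A n = 1 := isom_conj_mul _

lemma isomR_isomR (n : ℕ) : (isomR A n)ᴴ * isomR A n = 1 := isom_conj_mul _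

lemma isom_complete (n : ℕ) : isomL A n * (isomL A n)ᴴ + isomR A n * (isomR A n)ᴴ = 1 := by
  ext i j
  refine Fin.addCases (fun i => ?_) (fun i => ?_) i <;>
  refine Fin.addCases (fun j => ?_) (fun j => ?_) j <;>
  simp [Matrix.mul_apply, isomL, isomR, isom_apply, apply_ite star, castAdd_ne_addNat,
    (castAdd_ne_addNat _ _).symm, Matrix.one_apply, @eq_comm _ i j]

/-- The matrix `[[0, -1], [1, 0]]` in `M_{2n}(A)`. -/
def flip (n : ℕ) : Matrix (Fin (n + n)) (Fin (n + n)) A :=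
  isomR A n * (isomL A n)ᴴ - isomL A n * (isomR A n)ᴴ

lemma flip_conjTranspose (n : ℕ) : (flip n : Matrix _ _ A)ᴴ = -flip n := by
  simp [flip, Matrix.conjTranspose_mul]

lemma flip_mul_isomL (n : ℕ) : (flip n : Matrix _ _ A) * isomL A n = isomR A n := by
  simp [flip, Matrix.sub_mul, Matrix.mul_assoc, isomR_isomL, isomL_isomL]

lemma flip_mul_isomR (n : ℕ) : (flip n : Matrix _ _ A) * isomR A n = -isomL A n := by
  simp [flip, Matrix.sub_mul, Matrix.mul_assoc, isomL_isomR, isomR_isomR]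

lemma flip_mul_flip (n : ℕ) : (flip n : Matrix _ _ A) * flip n = -1 := by
  have h : (flip n : Matrix _ _ A) * (isomR A n * (isomL A n)ᴴ - isomL A n * (isomR A n)ᴴ)
      = -1 := by
    rw [Matrix.mul_sub, ← Matrix.mul_assoc, ← Matrix.mul_assoc, flip_mul_isomR, flip_mul_isomL,
      ← isom_complete n, Matrix.neg_mul]
    abel
  exact h

/-- The rotation `[[0, -1], [1, 0]]` as a unitary of the C⋆-algebra `M_{2n}(A)`. -/
def flipUnitary (n : ℕ) : unitary (Mat (n + n) A) :=
  ⟨matEquiv (n + n) A (flip n), by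
    have h : star (flip n : Matrix _ _ A) = -flip n := flip_conjTranspose n
    rw [Unitary.mem_iff, ← map_star, h, ← map_mul, ← map_mul]
    simp [flip_mul_flip]⟩

lemma joined_flipUnitary (n : ℕ) : Joined 1 (flipUnitary n : unitary (Mat (n + n) A)) := by
  refine Unitary.joined _ _ ?_
  set W : Mat (n + n) A := (flipUnitary (A := A) n : Mat (n + n) A)
  have hs : star W = -W := by
    change star (matEquiv (n + n) A (flip n)) = _
    rw [← map_star, Matrix.star_eq_conjTranspose, flip_conjTranspose, map_neg]
    rfl
  have hW : W * star W = 1 := Unitary.coe_mul_star_self _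
  have h1 : (W - 1) * star (W - 1) = 1 + 1 := by
    rw [star_sub, star_one, mul_sub, sub_mul, sub_mul, hW, hs]
    simp only [one_mul, mul_one]
    abel
  have h2 : ‖W - ((1 : unitary (Mat (n + n) A)) : Mat (n + n) A)‖ ^ 2 ≤ 2 := by
    rw [sq, OneMemClass.coe_one, ← CStarRing.norm_self_mul_star, h1]
    rcases subsingleton_or_nontrivial (Mat (n + n) A) with h | h
    · rw [Subsingleton.elim (1 + 1 : Mat (n + n) A) 0, norm_zero]; norm_num
    · refine (norm_add_le _ _).trans ?_
      rw [CStarRing.norm_one]; norm_num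
  nlinarith [norm_nonneg (W - ((1 : unitary (Mat (n + n) A)) : Mat (n + n) A))]

/-- The upper left corner embedding `M_n(A) → M_{2n}(A)`. -/
def cornerL (n : ℕ) : Mat n A →⋆ₙₐ[ℂ] Mat (n + n) A := corner (Fin.castAddEmb n)

/-- The lower right corner embedding `M_n(A) → M_{2n}(A)`. -/
def cornerR (n : ℕ) : Mat n A →⋆ₙₐ[ℂ] Mat (n + n) A := corner (Fin.natAddEmb n)

lemma cornerL_def (n : ℕ) (x : Mat n A) : cornerL n x = matEquiv (n + n) A
    (isomL A n * entries x * (isomL A n)ᴴ) := rfl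

lemma cornerR_def (n : ℕ) (x : Mat n A) : cornerR n x = matEquiv (n + n) A
    (isomR A n * entries x * (isomR A n)ᴴ) := rfl

lemma flipUnitary_conj (n : ℕ) (x : Mat n A) :
    (flipUnitary (A := A) n : Mat (n + n) A) * cornerL n x
      * star (flipUnitary (A := A) n : Mat (n + n) A) = cornerR n x := by
  have h1 : (flipUnitary (A := A) n : Mat (n + n) A) = matEquiv (n + n) A (flip n) :=
    rfl
  rw [h1, ← map_star, cornerL_def, cornerR_def, ← map_mul, ← map_mul, ← flip_mul_isomL,
    Matrix.conjTranspose_mul, Matrix.star_eq_conjTranspose]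
  simp only [Matrix.mul_assoc]

lemma cornerL_mul_cornerR (n : ℕ) (x y : Mat n A) : cornerL n x * cornerR n y = 0 := by
  rw [cornerL_def, cornerR_def, ← map_mul, Matrix.mul_assoc (isomR A n),
    Matrix.mul_assoc _ (isomL A n)ᴴ, ← Matrix.mul_assoc (isomL A n)ᴴ, isomL_isomR]
  simp

lemma cornerR_mul_cornerL (n : ℕ) (x y : Mat n A) : cornerR n x * cornerL n y = 0 := by
  rw [cornerL_def, cornerR_def, ← map_mul, Matrix.mul_assoc (isomL A n),
    Matrix.mul_assoc _ (isomR A n)ᴴ, ← Matrix.mul_assoc (isomR A n)ᴴ, isomR_isomL]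
  simp

lemma stab_eq_cornerL (n : ℕ) :
    stab A n (n + n) (Nat.le_add_left n n) = unitaryExtend (cornerL n) := rfl

open scoped commutatorElement in
lemma continuous_commutator_conj {G : Type*} [Group G] [TopologicalSpace G] [IsTopologicalGroup G]
    (U V : G) : Continuous fun w : G => ⁅U, w * V * w⁻¹⁆ := by
  simp only [commutatorElement_def]
  fun_prop

open scoped commutatorElement in
/-- Whitehead's lemma: commutators become connected to `1` after stabilisation. -/
lemma joined_commutator (n : ℕ) (u v : unitary (Mat n A)) :
    Joined 1 (stab A n (n + n) (Nat.le_add_left n n) ⁅u, v⁆) := by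
  rw [stab_eq_cornerL, map_commutatorElement]
  have hconj : flipUnitary n * unitaryExtend (cornerL n) v * (flipUnitary n)⁻¹
      = unitaryExtend (cornerR n) v := by
    ext : 1
    rw [← Unitary.star_eq_inv, Submonoid.coe_mul, Submonoid.coe_mul, Unitary.coe_star,
      coe_unitaryExtend, coe_unitaryExtend, mul_add, add_mul, mul_sub, sub_mul, flipUnitary_conj,
      flipUnitary_conj, mul_one, Unitary.mul_star_self_of_mem (flipUnitary (A := A) n).2]
  have hcomm : unitaryExtend (cornerL n) u * unitaryExtend (cornerR n) v
      = unitaryExtend (cornerR n) v * unitaryExtend (cornerL n) u := by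
    ext : 1
    simp only [Submonoid.coe_mul, coe_unitaryExtend, mul_add, add_mul, mul_sub, sub_mul,
      cornerL_mul_cornerR, cornerR_mul_cornerL, mul_one, one_mul]
    abel
  generalize unitaryExtend (cornerL n) u = U at *
  generalize unitaryExtend (cornerL n) v = V at *
  have hc := continuous_commutator_conj U V
  have hJ := ((joined_flipUnitary (A := A) n).map hc).symm
  rw [hconj, commutatorElement_eq_one_iff_mul_comm.2 hcomm] at hJ
  simpa using hJ

end Whitehead

section KGroups

variable (A : Type*) [CStarAlgebra A]

/-- `U_0^∞(A)`: the classes of unitaries that are connected to `1` by a path in some `U_n(A)`. -/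
def U0Inf : Subgroup (UInf A) where
  carrier := {x | ∃ (n : ℕ) (u : unitary (Mat n A)), Joined 1 u ∧ x = toUInf n u}
  one_mem' := ⟨0, 1, Joined.refl 1, (map_one _).symm⟩
  mul_mem' := by
    rintro _ _ ⟨n, u, hu, rfl⟩ ⟨m, v, hv, rfl⟩
    refine ⟨max n m, stab A n _ (le_max_left n m) u * stab A m _ (le_max_right n m) v, ?_, ?_⟩
    · simpa using (hu.map (continuous_stab (le_max_left n m))).mul
        (hv.map (continuous_stab (le_max_right n m)))
    · rw [map_mul, toUInf_stab, toUInf_stab]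
  inv_mem' := by
    rintro _ ⟨n, u, hu, rfl⟩
    exact ⟨n, u⁻¹, by simpa using hu.map continuous_inv, (map_inv _ _).symm⟩

open scoped commutatorElement in
lemma commutator_le_U0Inf : commutator (UInf A) ≤ U0Inf A := by
  rw [commutator_def, Subgroup.commutator_le]
  intro x _ y _
  obtain ⟨n, u, v, rfl, rfl⟩ := exists_toUInf₂ x y
  exact ⟨n + n, _, joined_commutator n u v, by rw [toUInf_stab, map_commutatorElement]⟩

/-- `\overline{DU^∞(A)}`: the closure of the commutator subgroup of `U^∞(A)`. -/
def DBar : Subgroup (UInf A) := closureSubgroup (commutator (UInf A))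

/-- `\overline{U_0^∞(A)}`. -/
def U0Bar : Subgroup (UInf A) := closureSubgroup (U0Inf A)

lemma DBar_le_U0Bar : DBar A ≤ U0Bar A := closureSubgroup_mono (commutator_le_U0Inf A)

lemma normal_of_commutator_le {G : Type*} [Group G] {N : Subgroup G} (h : commutator G ≤ N) :
    N.Normal :=
  Subgroup.commutator_top_left_le_iff.1
    ((Subgroup.commutator_mono le_rfl le_top).trans (by rwa [commutator_def] at h))

open scoped commutatorElement in
lemma quotient_mul_comm {G : Type*} [Group G] {N : Subgroup G} [N.Normal] (h : commutator G ≤ N)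
    (x y : G ⧸ N) : x * y = y * x := by
  induction x using QuotientGroup.induction_on with | H x => ?_
  induction y using QuotientGroup.induction_on with | H y => ?_
  rw [← QuotientGroup.mk_mul, ← QuotientGroup.mk_mul, QuotientGroup.eq]
  refine h ?_
  have : (x * y)⁻¹ * (y * x) = ⁅y⁻¹, x⁻¹⁆ := by simp [commutatorElement_def, mul_assoc]
  rw [this, commutator_def]
  exact Subgroup.commutator_mem_commutator (Subgroup.mem_top _) (Subgroup.mem_top _)

instance : (DBar A).Normal := normal_of_commutator_le (le_closureSubgroup _)

instance : (U0Bar A).Normal :=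
  normal_of_commutator_le ((commutator_le_U0Inf A).trans (le_closureSubgroup _))

instance : CommGroup (UInf A ⧸ DBar A) where
  mul_comm := quotient_mul_comm (le_closureSubgroup _)

instance : CommGroup (UInf A ⧸ U0Bar A) where
  mul_comm := quotient_mul_comm ((commutator_le_U0Inf A).trans (le_closureSubgroup _))

/-- The Hausdorffized algebraic `K_1`-group `U^∞(A) / \overline{DU^∞(A)}`, written additively. -/
def K1Bar : Type _ := Additive (UInf A ⧸ DBar A)

instance : AddCommGroup (K1Bar A) := inferInstanceAs (AddCommGroup (Additive (UInf A ⧸ DBar A)))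

/-- The topological `K_1`-group `U^∞(A) / \overline{U_0^∞(A)}`, written additively. -/
def K1 : Type _ := Additive (UInf A ⧸ U0Bar A)

instance : AddCommGroup (K1 A) := inferInstanceAs (AddCommGroup (Additive (UInf A ⧸ U0Bar A)))

variable {A}

variable (A) in
/-- The quotient map onto the Hausdorffized algebraic `K_1`-group. -/
def barHom : UInf A →* Multiplicative (K1Bar A) where
  toFun u := Multiplicative.ofAdd (Additive.ofMul (QuotientGroup.mk' (DBar A) u))
  map_one' := rfl
  map_mul' _ _ := rfl

/-- The class of `u ∈ U^∞(A)` in the Hausdorffized algebraic `K_1`-group. -/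
def barClass (u : UInf A) : K1Bar A := (barHom A u).toAdd

lemma barHom_eq_one_iff {u : UInf A} : barHom A u = 1 ↔ u ∈ DBar A :=
  QuotientGroup.eq_one_iff (N := DBar A) u

/-- The class of `u ∈ U^∞(A)` in `K_1(A)`. -/
def k1Class (u : UInf A) : K1 A := Additive.ofMul (QuotientGroup.mk' (U0Bar A) u)

variable (A) in
/-- The quotient map `π` from the Hausdorffized algebraic `K_1`-group onto `K_1(A)`. -/
def piHom : K1Bar A →+ K1 A :=
  MonoidHom.toAdditive (QuotientGroup.map (DBar A) (U0Bar A) (MonoidHom.id _) (DBar_le_U0Bar A))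

@[simp] lemma piHom_barClass (u : UInf A) : piHom A (barClass u) = k1Class u := rfl

variable {B : Type*} [CStarAlgebra B]

/-- The map `U_n(A) → U_n(B)`, `u ↦ φ(u) + (1 - φ(1))`, with `φ` acting entrywise. -/
def matUnitaryMap (φ : A →⋆ₙₐ[ℂ] B) (n : ℕ) : unitary (Mat n A) →* unitary (Mat n B) :=
  unitaryExtend (matMap φ n)

lemma stab_matUnitaryMap (φ : A →⋆ₙₐ[ℂ] B) (n m : ℕ) (h : n ≤ m) (u : unitary (Mat n A)) :
    stab B n m h (matUnitaryMap φ n u) = matUnitaryMap φ m (stab A n m h u) := by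
  rw [stab, stab, matUnitaryMap, matUnitaryMap, unitaryExtend_comp, unitaryExtend_comp]
  refine congrArg (fun f => unitaryExtend f u) ?_
  refine DFunLike.ext _ _ fun y => ?_
  rw [NonUnitalStarAlgHom.comp_apply, NonUnitalStarAlgHom.comp_apply, corner_map]

/-- The map underlying `U^∞(φ)`; at level `n` it is `u ↦ φ(u) + (1 - φ(1))`. -/
def uInfFun (φ : A →⋆ₙₐ[ℂ] B) : UInf A → UInf B :=
  DirectLimit.lift (stab A) (fun n u => toUInf n (matUnitaryMap φ n u))
    fun n m h u => by rw [← stab_matUnitaryMap, toUInf_stab]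

lemma uInfFun_toUInf (φ : A →⋆ₙₐ[ℂ] B) (n : ℕ) (u : unitary (Mat n A)) :
    uInfFun φ (toUInf n u) = toUInf n (matUnitaryMap φ n u) := rfl

/-- The group morphism `U^∞(φ)`. -/
def uInfMap (φ : A →⋆ₙₐ[ℂ] B) : UInf A →* UInf B where
  toFun := uInfFun φ
  map_one' := by
    rw [← map_one (toUInf (A := A) 0), uInfFun_toUInf, map_one, map_one]
  map_mul' x y := by
    obtain ⟨n, u, v, rfl, rfl⟩ := exists_toUInf₂ x y
    rw [← map_mul, uInfFun_toUInf, uInfFun_toUInf, uInfFun_toUInf, map_mul, map_mul]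

lemma uInfMap_toUInf (φ : A →⋆ₙₐ[ℂ] B) (n : ℕ) (u : unitary (Mat n A)) :
    uInfMap φ (toUInf n u) = toUInf n (matUnitaryMap φ n u) := rfl

lemma continuous_uInfMap (φ : A →⋆ₙₐ[ℂ] B) : Continuous (uInfMap φ) :=
  (continuous_uInf_iff _).2 fun n => by
    simp only [uInfMap_toUInf]
    exact (continuous_toUInf n).comp (continuous_unitaryExtend _)

lemma closureSubgroup_le_comap (φ : A →⋆ₙₐ[ℂ] B) {N : Subgroup (UInf A)} {M : Subgroup (UInf B)}
    (h : N ≤ M.comap (uInfMap φ)) :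
    closureSubgroup N ≤ (closureSubgroup M).comap (uInfMap φ) :=
  fun _ hx => map_mem_closure (continuous_uInfMap φ) hx h

lemma DBar_le_comap (φ : A →⋆ₙₐ[ℂ] B) : DBar A ≤ (DBar B).comap (uInfMap φ) := by
  refine closureSubgroup_le_comap φ ?_
  rw [commutator_def, commutator_def, Subgroup.commutator_le]
  intro x _ y _
  rw [Subgroup.mem_comap, map_commutatorElement]
  exact Subgroup.commutator_mem_commutator (Subgroup.mem_top _) (Subgroup.mem_top _)

lemma U0Bar_le_comap (φ : A →⋆ₙₐ[ℂ] B) : U0Bar A ≤ (U0Bar B).comap (uInfMap φ) := by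
  refine closureSubgroup_le_comap φ ?_
  rintro _ ⟨n, u, hu, rfl⟩
  have h : Continuous (matUnitaryMap φ n) := continuous_unitaryExtend _
  exact ⟨n, matUnitaryMap φ n u, by simpa using hu.map h, rfl⟩

/-- The morphism induced by `φ` between the Hausdorffized algebraic `K_1`-groups. -/
def K1BarMap (φ : A →⋆ₙₐ[ℂ] B) : K1Bar A →+ K1Bar B :=
  MonoidHom.toAdditive (QuotientGroup.map (DBar A) (DBar B) (uInfMap φ) (DBar_le_comap φ))

/-- The morphism `K_1(φ)`. -/
def K1Map (φ : A →⋆ₙₐ[ℂ] B) : K1 A →+ K1 B :=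
  MonoidHom.toAdditive (QuotientGroup.map (U0Bar A) (U0Bar B) (uInfMap φ) (U0Bar_le_comap φ))

end KGroups

section Trace

variable {R S : Type*} [CStarAlgebra R] [CStarAlgebra S]

/-- `[R, R]`, the additive subgroup generated by the commutators `ab - ba`. -/
def addCommutators (R : Type*) [Ring R] : AddSubgroup R :=
  AddSubgroup.closure {x | ∃ a b : R, x = a * b - b * a}

lemma sub_mem_addCommutators {T : Type*} [Ring T] (a b : T) : a * b - b * a ∈ addCommutators T :=
  AddSubgroup.subset_closure ⟨a, b, rfl⟩

variable (R) in
/-- The universal trace, the quotient map of `R` by the closure of `[R, R]`. -/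
def universalTrace : R →+ R ⧸ (addCommutators R).topologicalClosure :=
  QuotientAddGroup.mk' _

variable (R) in
/-- `R_0 = {h ∈ R_sa | Tr(h) = 0}` for the universal trace `Tr`. -/
def traceZero : AddSubgroup (selfAdjoint R) :=
  ((universalTrace R).comp (selfAdjoint R).subtype).ker

lemma mem_traceZero {h : selfAdjoint R} :
    h ∈ traceZero R ↔ (h : R) ∈ (addCommutators R).topologicalClosure := by
  simp [traceZero, universalTrace, AddMonoidHom.mem_ker]

/-- The restriction of a ⋆-homomorphism to self-adjoint elements. -/
def saMap (f : R →⋆ₙₐ[ℂ] S) : selfAdjoint R →+ selfAdjoint S where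
  toFun h := ⟨f h, by rw [selfAdjoint.mem_iff, ← map_star, h.2.star_eq]⟩
  map_zero' := by ext; simp
  map_add' x y := by ext; simp

@[simp] lemma coe_saMap (f : R →⋆ₙₐ[ℂ] S) (h : selfAdjoint R) : (saMap f h : S) = f h := rfl

lemma continuous_saMap (f : R →⋆ₙₐ[ℂ] S) : Continuous (saMap f) :=
  Continuous.subtype_mk ((continuous_hom f).comp continuous_subtype_val) _

lemma addCommutators_le_comap (f : R →⋆ₙₐ[ℂ] S) :
    addCommutators R ≤ (addCommutators S).comap (f : R →+ S) := by
  rw [addCommutators, AddSubgroup.closure_le]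
  rintro _ ⟨a, b, rfl⟩
  change f (a * b - b * a) ∈ addCommutators S
  rw [map_sub, map_mul, map_mul]
  exact sub_mem_addCommutators _ _

lemma traceZero_le_comap (f : R →⋆ₙₐ[ℂ] S) : traceZero R ≤ (traceZero S).comap (saMap f) := by
  intro h hh
  rw [mem_traceZero] at hh
  have h1 : f (h : R) ∈ closure (addCommutators S : Set S) :=
    map_mem_closure (continuous_hom f) hh (addCommutators_le_comap f)
  exact mem_traceZero.2 h1

end Trace

section Exp

open NormedSpace Filter Topology selfAdjoint

variable {R S : Type*} [CStarAlgebra R] [CStarAlgebra S]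

lemma norm_pow_sub_pow_le (x y : unitary R) (n : ℕ) :
    ‖((x ^ n : unitary R) : R) - (y ^ n : unitary R)‖ ≤ n * ‖(x : R) - y‖ := by
  induction n with
  | zero => simp
  | succ n ih =>
    have : ((x ^ (n + 1) : unitary R) : R) - (y ^ (n + 1) : unitary R)
        = x * (((x ^ n : unitary R) : R) - (y ^ n : unitary R))
          + ((x : R) - y) * (y ^ n : unitary R) := by
      simp only [pow_succ', Submonoid.coe_mul]
      noncomm_ring
    rw [this]
    refine (norm_add_le _ _).trans ?_
    rw [CStarRing.norm_coe_unitary_mul, CStarRing.norm_mul_coe_unitary]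
    rw [Nat.cast_succ]
    linarith

lemma expUnitary_nsmul (n : ℕ) (h : selfAdjoint R) : expUnitary (n • h) = expUnitary h ^ n := by
  induction n with
  | zero => simp
  | succ n ih =>
    rw [succ_nsmul, pow_succ, ← ih]
    refine Commute.expUnitary_add ?_
    have : ((n • h : selfAdjoint R) : R) = n • (h : R) := by simp
    rw [this]
    exact (Commute.refl _).smul_left n

/-- The Lie product formula for unitary exponentials. -/
lemma tendsto_expUnitary_mul_pow (h k : selfAdjoint R) :
    Tendsto (fun n : ℕ => (expUnitary ((n : ℝ)⁻¹ • h) * expUnitary ((n : ℝ)⁻¹ • k)) ^ n) atTop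
      (𝓝 (expUnitary (h + k))) := by
  rw [tendsto_subtype_rng]
  let a : R := Complex.I • (h : R)
  let b : R := Complex.I • (k : R)
  let F : ℝ → R := fun t => exp (t • a) * exp (t • b) - exp (t • (a + b))
  have hF : HasDerivAt F 0 0 := by
    have h1 := hasDerivAt_exp_smul_const (𝕂 := ℝ) a 0
    have h2 := hasDerivAt_exp_smul_const (𝕂 := ℝ) b 0
    have h3 := hasDerivAt_exp_smul_const (𝕂 := ℝ) (a + b) 0
    have h4 := (h1.mul h2).sub h3
    simp only [zero_smul, exp_zero, one_mul, mul_one, sub_self] at h4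
    exact h4
  have hF0 : F 0 = 0 := by simp [F]
  have hlim : Tendsto (fun n : ℕ => (n : ℝ) * ‖F ((n : ℝ)⁻¹)‖) atTop (𝓝 0) := by
    have h1 := (hasDerivAt_iff_tendsto_slope.1 hF).norm
    have h2 : Tendsto (fun n : ℕ => (n : ℝ)⁻¹) atTop (𝓝[≠] (0 : ℝ)) := by
      refine tendsto_nhdsWithin_iff.2 ⟨tendsto_inv_atTop_nhds_zero_nat, ?_⟩
      filter_upwards [eventually_gt_atTop 0] with n hn
      simp [hn.ne']
    have h3 := h1.comp h2
    rw [norm_zero] at h3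
    refine h3.congr fun n => ?_
    simp [slope, hF0, norm_smul]
  rw [tendsto_iff_norm_sub_tendsto_zero]
  refine squeeze_zero' (Eventually.of_forall fun _ => norm_nonneg _) ?_ hlim
  filter_upwards [eventually_gt_atTop 0] with n hn
  have h1 : expUnitary (h + k) = expUnitary ((n : ℝ)⁻¹ • (h + k)) ^ n := by
    rw [← expUnitary_nsmul, ← Nat.cast_smul_eq_nsmul ℝ, smul_smul,
      mul_inv_cancel₀ (by exact_mod_cast hn.ne'), one_smul]
  rw [h1]
  refine (norm_pow_sub_pow_le _ _ n).trans (le_of_eq ?_)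
  have h5 : ∀ x : R, Complex.I • ((n : ℝ)⁻¹ • x) = (n : ℝ)⁻¹ • (Complex.I • x) :=
    fun x => smul_comm _ _ _
  simp only [F, a, b, Submonoid.coe_mul, expUnitary_coe, selfAdjoint.val_smul,
    AddSubgroup.coe_add, h5, smul_add]

lemma exp_hom (f : R →⋆ₙₐ[ℂ] S) (x : R) : exp (f x) = f (exp x) + (1 - f 1) := by
  have h1 := (exp_series_hasSum_exp' (𝕂 := ℂ) x).map f (continuous_hom f)
  have h2 : HasSum (fun n : ℕ => if n = 0 then (1 : S) - f 1 else 0) (1 - f 1) :=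
    hasSum_ite_eq 0 _
  refine (exp_series_hasSum_exp' (𝕂 := ℂ) (f x)).unique ?_
  convert h1.add h2 using 2 with n
  rcases n with _ | n
  · simp
  · have h3 : ∀ n : ℕ, f x ^ (n + 1) = f (x ^ (n + 1)) := fun n => by
      induction n with
      | zero => simp
      | succ n ih => rw [pow_succ, ih, pow_succ x (n + 1), map_mul]
    simp [h3]

lemma expUnitary_saMap (f : R →⋆ₙₐ[ℂ] S) (h : selfAdjoint R) :
    expUnitary (saMap f h) = unitaryExtend f (expUnitary h) := by
  ext : 1
  rw [expUnitary_coe, coe_unitaryExtend, expUnitary_coe, coe_saMap, ← map_smul, exp_hom]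

lemma expUnitary_conj (u : unitary R) (h h' : selfAdjoint R) (hh : (h' : R) = u * h * star (u : R)) :
    expUnitary h' = u * expUnitary h * u⁻¹ := by
  ext : 1
  let _ : NormedAlgebra ℚ R := .restrictScalars ℚ ℂ R
  have := exp_units_conj (Unitary.toUnits u) (Complex.I • (h : R))
  rw [← Unitary.star_eq_inv]
  simp only [expUnitary_coe, Submonoid.coe_mul, hh]
  rw [← smul_mul_assoc, ← mul_smul_comm]
  exact this

variable {G : Type*} [AddCommGroup G] (q : unitary R →* Multiplicative G)

/-- The map `h ↦ q(exp(2πih))`, for a homomorphism `q` with closed kernel from the unitary group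
to an abelian group, is additive. -/
def expHom (hq : IsClosed {u | q u = 1}) : selfAdjoint R →+ G :=
  AddMonoidHom.mk' (fun h => Multiplicative.toAdd (q (expUnitary ((2 * Real.pi) • h)))) fun h k => by
    rw [← toAdd_mul, smul_add]
    congr 1
    generalize (2 * Real.pi) • h = h
    generalize (2 * Real.pi) • k = k
    rw [← map_mul]
    set w := expUnitary h * expUnitary k
    have hcl : IsClosed {u | q u = q w} := by
      have h1 : IsClosed ((fun u => w⁻¹ * u) ⁻¹' {u | q u = 1}) :=
        hq.preimage (continuous_const.mul continuous_id)
      convert h1 using 1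
      ext u
      change q u = q w ↔ q (w⁻¹ * u) = 1
      rw [map_mul q w⁻¹, map_inv q w, inv_mul_eq_one, eq_comm]
    refine hcl.mem_of_tendsto (tendsto_expUnitary_mul_pow h k) ?_
    filter_upwards [eventually_gt_atTop 0] with n hn
    have h1 : ∀ h : selfAdjoint R, expUnitary h = expUnitary ((n : ℝ)⁻¹ • h) ^ n := fun h => by
      rw [← expUnitary_nsmul, ← Nat.cast_smul_eq_nsmul ℝ, smul_smul,
        mul_inv_cancel₀ (by exact_mod_cast hn.ne'), one_smul]
    change q (_ ^ n) = q w
    rw [map_pow, map_mul, mul_pow, ← map_pow, ← map_pow, ← h1, ← h1, ← map_mul]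

variable {q}

lemma expHom_apply (hq : IsClosed {u | q u = 1}) (h : selfAdjoint R) :
    expHom q hq h = Multiplicative.toAdd (q (expUnitary ((2 * Real.pi) • h))) := rfl

lemma isClosed_ker_expHom (hq : IsClosed {u | q u = 1}) :
    IsClosed {h | expHom q hq h = 0} := by
  have : Continuous fun h : selfAdjoint R => expUnitary ((2 * Real.pi) • h) :=
    continuous_expUnitary.comp (continuous_const_smul _)
  exact hq.preimage this

/-- `i(kh - hk)` as a self-adjoint element, for self-adjoint `k` and `h`. -/
def saComm (k h : selfAdjoint R) : selfAdjoint R :=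
  ⟨Complex.I • ((k : R) * h - h * k), by
    rw [selfAdjoint.mem_iff, star_smul, star_sub, star_mul, star_mul, k.2.star_eq, h.2.star_eq]
    simp [← smul_neg]⟩

/-- The conjugate `u h u⋆`. -/
def saConj (u : unitary R) (h : selfAdjoint R) : selfAdjoint R :=
  ⟨u * h * star (u : R), h.2.conjugate _⟩

lemma expHom_saConj (hq : IsClosed {u | q u = 1}) (u : unitary R) (h : selfAdjoint R) :
    expHom q hq (saConj u h) = expHom q hq h := by
  rw [expHom_apply, expHom_apply]
  congr 1
  rw [expUnitary_conj u ((2 * Real.pi) • h) ((2 * Real.pi) • saConj u h), map_mul, map_mul,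
    map_inv, mul_right_comm, mul_inv_cancel, one_mul]
  simp [saConj]

lemma expHom_saComm (hq : IsClosed {u | q u = 1}) (k h : selfAdjoint R) :
    expHom q hq (saComm k h) = 0 := by
  let a : R := Complex.I • (k : R)
  let F : ℝ → R := fun t => exp (t • a) * h * exp (t • (-a))
  have hG : HasDerivAt F (a * h - h * a) 0 := by
    have h1 := hasDerivAt_exp_smul_const (𝕂 := ℝ) a 0
    have h2 := hasDerivAt_exp_smul_const (𝕂 := ℝ) (-a) 0
    have h4 := (h1.mul_const (h : R)).mul h2
    simp only [zero_smul, exp_zero, one_mul, mul_one, mul_neg, ← sub_eq_add_neg] at h4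
    exact h4
  have hG0 : F 0 = h := by simp [F]
  let y : ℝ → selfAdjoint R := fun t =>
    saConj (expUnitary (t • k)) (t⁻¹ • h) - t⁻¹ • h
  have hy : ∀ t, expHom q hq (y t) = 0 := fun t => by
    simp only [y]
    rw [map_sub, expHom_saConj, sub_self]
  have hlim : Tendsto y (𝓝[≠] 0) (𝓝 (saComm k h)) := by
    rw [tendsto_subtype_rng]
    have h1 := hasDerivAt_iff_tendsto_slope.1 hG
    have h2 : a * h - h * a = saComm k h := by simp [a, saComm, smul_sub]
    rw [h2] at h1
    refine h1.congr fun t => ?_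
    have h3 : star (exp (t • a)) = exp (t • (-a)) := by
      rw [star_exp]
      simp [a, k.2.star_eq]
    have h4 : ((expUnitary (t • k) : unitary R) : R) = exp (t • a) := by
      simp only [expUnitary_coe, a, selfAdjoint.val_smul]
      rw [smul_comm]
    simp only [slope, hG0, y, F, sub_zero, AddSubgroup.coe_sub, saConj, selfAdjoint.val_smul, h4, h3,
      vsub_eq_sub, smul_sub, mul_smul_comm, smul_mul_assoc]
  exact (isClosed_ker_expHom hq).mem_of_tendsto hlim (Eventually.of_forall hy)

lemma realPart_commutator (a b : R) :
    realPart (a * b - b * a) = saComm (realPart a) (imaginaryPart b)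
      + saComm (imaginaryPart a) (realPart b) := by
  have h : a * b - b * a = ((saComm (realPart a) (imaginaryPart b)
      + saComm (imaginaryPart a) (realPart b) : selfAdjoint R) : R)
      + Complex.I • ((saComm (imaginaryPart a) (imaginaryPart b)
        - saComm (realPart a) (realPart b) : selfAdjoint R) : R) := by
    conv_lhs => rw [← realPart_add_I_smul_imaginaryPart a, ← realPart_add_I_smul_imaginaryPart b]
    simp only [saComm, AddSubgroup.coe_add, AddSubgroup.coe_sub, mul_add, add_mul, smul_sub,
      smul_add, smul_mul_assoc, mul_smul_comm, smul_smul, Complex.I_mul_I, neg_smul, one_smul]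
    abel
  rw [h, map_add, realPart_I_smul, selfAdjoint.realPart_coe, selfAdjoint.imaginaryPart_coe,
    neg_zero, add_zero]

lemma continuous_realPart : Continuous fun x : R => realPart x := by
  refine Continuous.subtype_mk (f := fun x : R => (2⁻¹ : ℝ) • (x + star x)) ?_ _
  fun_prop

/-- `q(exp(2πih)) = 1` if the universal trace of `h` vanishes. -/
lemma expHom_eq_zero_of_mem_traceZero (hq : IsClosed {u | q u = 1}) {h : selfAdjoint R}
    (hh : h ∈ traceZero R) : expHom q hq h = 0 := by
  rw [mem_traceZero] at hh
  let N : AddSubgroup R := ((expHom q hq).comp (realPart (A := R)).toAddMonoidHom).ker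
  have hN : IsClosed (N : Set R) := (isClosed_ker_expHom hq).preimage continuous_realPart
  have hle : addCommutators R ≤ N := by
    rw [addCommutators, AddSubgroup.closure_le]
    rintro _ ⟨a, b, rfl⟩
    change expHom q hq (realPart (a * b - b * a)) = 0
    rw [realPart_commutator, map_add, expHom_saComm, expHom_saComm, add_zero]
  have := AddSubgroup.topologicalClosure_minimal _ hle hN hh
  change expHom q hq (realPart (h : R)) = 0 at this
  rwa [selfAdjoint.realPart_coe] at this

lemma expHom_projection (hq : IsClosed {u | q u = 1}) (p : selfAdjoint R)
    (hp : (p : R) * p = p) : expHom q hq p = 0 := by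
  let f : ℂ →⋆ₙₐ[ℂ] R :=
    { toFun := fun z => z • (p : R)
      map_smul' := fun c z => by simp [mul_smul]
      map_zero' := by simp
      map_add' := fun z w => add_smul _ _ _
      map_mul' := fun z w => by
        rw [smul_mul_smul_comm, hp]
      map_star' := fun z => by rw [star_smul, p.2.star_eq] }
  have h1 : expUnitary ((2 * Real.pi) • p) = 1 := by
    ext : 1
    rw [expUnitary_coe, selfAdjoint.val_smul, ← Complex.coe_smul, smul_smul]
    change exp (f _) = _
    rw [exp_hom, ← Complex.exp_eq_exp_ℂ]
    have : Complex.I * ((2 * Real.pi : ℝ) : ℂ) = 2 * Real.pi * Complex.I := by push_cast; ring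
    rw [this, Complex.exp_two_pi_mul_I]
    simp
  rw [expHom_apply, h1, map_one, toAdd_one]

end Exp

section HGroup

open selfAdjoint

variable (A : Type*) [CStarAlgebra A]

/-- `A_sa / A_0`, which is identified with `Aff T_1(A)` by `[h] ↦ (τ ↦ τ(h))`. It carries the
quotient topology. -/
abbrev AffT : Type _ := selfAdjoint A ⧸ traceZero A

variable {A} in
/-- The diagonal sum of a self-adjoint matrix. -/
def diagSum {n : ℕ} (x : selfAdjoint (Mat n A)) : selfAdjoint A :=
  ⟨∑ i, entries (x : Mat n A) i i, by
    have h : star (entries (x : Mat n A)) = entries x := by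
      rw [entries, ← map_star, x.2.star_eq]
    rw [selfAdjoint.mem_iff, star_sum]
    exact Finset.sum_congr rfl fun i _ => congrFun (congrFun h i) i⟩

variable {A} in
/-- The extension `x ↦ Tr(x) = [∑ x_ii]` of the universal trace to self-adjoint matrices. -/
def matTrace {n : ℕ} (x : selfAdjoint (Mat n A)) : AffT A :=
  QuotientAddGroup.mk (diagSum x)

/-- The image of `K_0(A) → A_sa / A_0`, `[p] ↦ Tr(p)`, that is, the subgroup generated by the
traces of the projections in all the matrix algebras `M_n(A)`. -/
def K0Image : AddSubgroup (AffT A) :=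
  AddSubgroup.closure
    {t | ∃ (n : ℕ) (p : selfAdjoint (Mat n A)), (p : Mat n A) * p = p ∧ t = matTrace p}

/-- `H(A) = Aff T_1(A) / \overline{K_0(A)}`. -/
abbrev H : Type _ := AffT A ⧸ (K0Image A).topologicalClosure

variable {A}

lemma single_sub_mem {n : ℕ} (i j : Fin (n + 1)) (a : A) :
    Matrix.single i j a - (if i = j then Matrix.single 0 0 a else 0)
      ∈ addCommutators (Matrix (Fin (n + 1)) (Fin (n + 1)) A) := by
  by_cases h : i = j
  · subst h
    have := sub_mem_addCommutators (Matrix.single i (0 : Fin (n + 1)) a) (Matrix.single 0 i (1 : A))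
    simpa using this
  · have := sub_mem_addCommutators (Matrix.single i j a) (Matrix.single j j (1 : A))
    rw [Matrix.single_mul_single_same, Matrix.single_mul_single_of_ne _ _ _ _ (Ne.symm h)] at this
    simpa [h] using this

lemma matrix_sub_trace_mem {n : ℕ} (x : Matrix (Fin (n + 1)) (Fin (n + 1)) A) :
    x - Matrix.single 0 0 (∑ i, x i i)
      ∈ addCommutators (Matrix (Fin (n + 1)) (Fin (n + 1)) A) := by
  have h : x - Matrix.single 0 0 (∑ i, x i i) = ∑ i, ∑ j,
      (Matrix.single i j (x i j) - (if i = j then Matrix.single 0 0 (x i j) else 0)) := by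
    simp only [Finset.sum_sub_distrib, Finset.sum_ite_eq, Finset.mem_univ, if_true]
    rw [← Matrix.matrix_eq_sum_single]
    congr 1
    exact map_sum (Matrix.singleAddMonoidHom (0 : Fin (n + 1)) (0 : Fin (n + 1))) _ _
  rw [h]
  exact AddSubgroup.sum_mem _ fun i _ => AddSubgroup.sum_mem _ fun j _ => single_sub_mem i j _

variable (A) in
/-- The identification of `A` with `M_1(A)`. -/
def toMatOne : A →⋆ₙₐ[ℂ] Mat 1 A where
  toFun a := matEquiv 1 A (Matrix.of fun _ _ => a)
  map_smul' c a := by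
    rw [MonoidHom.id_apply, ← map_smul]
    exact congrArg _ (by ext; simp)
  map_zero' := by
    rw [← map_zero (matEquiv 1 A)]
    exact congrArg _ (by ext; simp)
  map_add' a b := by
    rw [← map_add]
    exact congrArg _ (by ext; simp)
  map_mul' a b := by
    rw [← map_mul]
    exact congrArg _ (by ext; simp [Matrix.mul_apply])
  map_star' a := by
    rw [← map_star]
    exact congrArg _ (by ext; simp [Matrix.star_apply])

lemma toMatOne_apply (a : A) (i j : Fin 1) : entries (toMatOne A a) i j = a :=
  congrFun (congrFun (entries_matEquiv (Matrix.of fun _ _ : Fin 1 => a)) i) j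

lemma corner_toMatOne {n : ℕ} (h : 1 ≤ n + 1) (a : A) :
    corner (Fin.castLEEmb h) (toMatOne A a) = matEquiv (n + 1) A (Matrix.single 0 0 a) := by
  have h0 : Fin.castLEEmb h 0 = 0 := rfl
  have hr : ∀ i : Fin (n + 1), i ∈ Set.range (Fin.castLEEmb h) ↔ i = 0 := fun i =>
    ⟨by rintro ⟨j, rfl⟩; rw [Subsingleton.elim j 0, h0], fun hi => ⟨0, by rw [h0, hi]⟩⟩
  refine entries_injective ?_
  rw [entries_matEquiv]
  ext i j
  by_cases hi : i = 0
  · by_cases hj : j = 0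
    · subst hi hj
      have := corner_apply_apply (Fin.castLEEmb h) (toMatOne A a) 0 0
      rw [h0, toMatOne_apply] at this
      rw [this]
      simp
    · rw [corner_apply_of_notMem _ _ (Or.inr (mt (hr j).1 hj))]
      simp [Ne.symm hj]
  · rw [corner_apply_of_notMem _ _ (Or.inl (mt (hr i).1 hi))]
    simp [Ne.symm hi]

lemma matEquiv_mem {n : ℕ} {x : Matrix (Fin n) (Fin n) A}
    (hx : x ∈ addCommutators (Matrix (Fin n) (Fin n) A)) :
    matEquiv n A x ∈ addCommutators (Mat n A) := by
  induction hx using AddSubgroup.closure_induction with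
  | mem x hx =>
    obtain ⟨a, b, rfl⟩ := hx
    rw [map_sub, map_mul, map_mul]
    exact sub_mem_addCommutators _ _
  | zero => rw [map_zero]; exact AddSubgroup.zero_mem _
  | add x y _ _ hx hy => rw [map_add]; exact AddSubgroup.add_mem _ hx hy
  | neg x _ hx => rw [map_neg]; exact AddSubgroup.neg_mem _ hx

lemma sub_corner_mem {n : ℕ} (x : selfAdjoint (Mat (n + 1) A)) :
    x - saMap (corner (Fin.castLEEmb (Nat.le_add_left 1 n))) (saMap (toMatOne A) (diagSum x))
      ∈ traceZero (Mat (n + 1) A) := by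
  rw [mem_traceZero]
  refine AddSubgroup.le_topologicalClosure _ ?_
  rw [AddSubgroup.coe_sub, coe_saMap, coe_saMap, corner_toMatOne]
  have h := matEquiv_mem (matrix_sub_trace_mem (entries (x : Mat (n + 1) A)))
  rwa [map_sub, matEquiv_entries] at h

lemma isClosed_ker_level (n : ℕ) :
    IsClosed {u : unitary (Mat n A) | ((barHom A).comp (toUInf n)) u = 1} := by
  have h : IsClosed ((toUInf n) ⁻¹' (DBar A : Set (UInf A))) :=
    (isClosed_closure (s := (commutator (UInf A) : Set (UInf A)))).preimage (continuous_toUInf n)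
  convert h using 1
  ext u
  exact barHom_eq_one_iff

variable (A) in
/-- The map sending a self-adjoint `h ∈ M_n(A)` to the class of `exp(2πih)`. -/
def expLevel (n : ℕ) : selfAdjoint (Mat n A) →+ K1Bar A :=
  expHom ((barHom A).comp (toUInf n)) (isClosed_ker_level n)

lemma expLevel_apply (n : ℕ) (h : selfAdjoint (Mat n A)) :
    expLevel A n h = barClass (toUInf n (expUnitary ((2 * Real.pi) • h))) := rfl

lemma expLevel_stab {n m : ℕ} (h : n ≤ m) (x : selfAdjoint (Mat n A)) :
    expLevel A m (saMap (corner (Fin.castLEEmb h)) x) = expLevel A n x := by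
  have h1 : (2 * Real.pi) • saMap (corner (Fin.castLEEmb h)) x
      = saMap (corner (Fin.castLEEmb h)) ((2 * Real.pi) • x) := by
    ext : 1
    simp only [selfAdjoint.val_smul, coe_saMap]
    have h2 : ∀ y : Mat n A, (2 * Real.pi) • y = ((2 * Real.pi : ℝ) : ℂ) • y :=
      fun y => (Complex.coe_smul _ y).symm
    have h3 : ∀ y : Mat m A, (2 * Real.pi) • y = ((2 * Real.pi : ℝ) : ℂ) • y :=
      fun y => (Complex.coe_smul _ y).symm
    rw [h2, h3, map_smul]
  rw [expLevel_apply, expLevel_apply, h1, expUnitary_saMap]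
  exact congrArg barClass (toUInf_stab h _)

variable (A) in
/-- The map sending a self-adjoint `h ∈ A` to the class of `exp(2πih)`. -/
def expClass : selfAdjoint A →+ K1Bar A := (expLevel A 1).comp (saMap (toMatOne A))

lemma expClass_apply (h : selfAdjoint A) :
    expClass A h
      = barClass (toUInf 1 (expUnitary ((2 * Real.pi) • saMap (toMatOne A) h))) := rfl

lemma expClass_eq_zero {h : selfAdjoint A} (hh : h ∈ traceZero A) : expClass A h = 0 :=
  expHom_eq_zero_of_mem_traceZero (isClosed_ker_level 1) (traceZero_le_comap (toMatOne A) hh)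

/-- The class of `exp(2πix)` only depends on the trace of `x`. -/
lemma expLevel_eq (n : ℕ) (x : selfAdjoint (Mat n A)) :
    expLevel A n x = expClass A (diagSum x) := by
  rcases n with _ | n
  · have h1 : x = 0 := Subtype.ext (entries_injective (by ext i; exact i.elim0))
    have h2 : diagSum x = 0 := Subtype.ext (by simp [diagSum])
    rw [h2, h1, map_zero, map_zero]
  · have h := expHom_eq_zero_of_mem_traceZero (isClosed_ker_level (n + 1)) (sub_corner_mem x)
    rw [map_sub, sub_eq_zero] at h
    exact h.trans (expLevel_stab _ _)

/-- The map `A_sa / A_0 → U^∞(A) / \overline{DU^∞(A)}`, `[h] ↦ [exp(2πih)]`. -/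
def expAffT : AffT A →+ K1Bar A :=
  QuotientAddGroup.lift (traceZero A) (expClass A) fun _ hh => expClass_eq_zero hh

lemma K0Image_le_ker : (K0Image A).topologicalClosure ≤ (expAffT (A := A)).ker := by
  refine AddSubgroup.topologicalClosure_minimal _ ?_ ?_
  · rw [K0Image, AddSubgroup.closure_le]
    rintro _ ⟨n, p, hp, rfl⟩
    change expClass A (diagSum p) = 0
    rw [← expLevel_eq]
    exact expHom_projection _ p hp
  · rw [← (QuotientAddGroup.isQuotientMap_mk (traceZero A)).isClosed_preimage]
    exact (isClosed_ker_expHom (isClosed_ker_level 1)).preimage (continuous_saMap (toMatOne A))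

variable (A) in
/-- The map `i` of the Nielsen–Thomsen sequence, `[h] ↦ [exp(2πih)]`. It is the composition of the
inverse of the isomorphism `U_0^∞(A) / \overline{DU^∞(A)} ≃ H(A)` given by the (non-stable)
de la Harpe–Skandalis determinant with the inclusion into `U^∞(A) / \overline{DU^∞(A)}`. -/
def iHom : H A →+ K1Bar A :=
  QuotientAddGroup.lift _ expAffT K0Image_le_ker

lemma iHom_mk (h : selfAdjoint A) :
    iHom A (QuotientAddGroup.mk (QuotientAddGroup.mk h : AffT A))
      = barClass (toUInf 1 (expUnitary ((2 * Real.pi) • saMap (toMatOne A) h))) := rfl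

variable {B : Type*} [CStarAlgebra B]

/-- The map `A_sa / A_0 → B_sa / B_0`, `[h] ↦ [φ(h)]`. -/
def affTMap (φ : A →⋆ₙₐ[ℂ] B) : AffT A →+ AffT B :=
  QuotientAddGroup.map _ _ (saMap φ) (traceZero_le_comap φ)

lemma continuous_affTMap (φ : A →⋆ₙₐ[ℂ] B) : Continuous (affTMap φ) :=
  (QuotientAddGroup.isQuotientMap_mk (traceZero A)).continuous_iff.2
    ((QuotientAddGroup.isQuotientMap_mk (traceZero B)).continuous.comp (continuous_saMap φ))

lemma affTMap_matTrace (φ : A →⋆ₙₐ[ℂ] B) {n : ℕ} (x : selfAdjoint (Mat n A)) :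
    affTMap φ (matTrace x) = matTrace (saMap (matMap φ n) x) := by
  refine congrArg QuotientAddGroup.mk (Subtype.ext ?_)
  change φ (∑ i, entries (x : Mat n A) i i) = ∑ i, entries (matMap φ n (x : Mat n A)) i i
  rw [map_sum, entries_matMap]
  rfl

lemma matTrace_mem {n : ℕ} (p : selfAdjoint (Mat n A)) (hp : (p : Mat n A) * p = p) :
    matTrace p ∈ K0Image A :=
  AddSubgroup.subset_closure ⟨n, p, hp, rfl⟩

lemma saMap_mul_self {R S : Type*} [CStarAlgebra R] [CStarAlgebra S] (f : R →⋆ₙₐ[ℂ] S)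
    (p : selfAdjoint R) (hp : (p : R) * p = p) : (saMap f p : S) * saMap f p = saMap f p := by
  rw [coe_saMap, ← map_mul, hp]

lemma affTMap_matTrace_mem (φ : A →⋆ₙₐ[ℂ] B) {n : ℕ} (p : selfAdjoint (Mat n A))
    (hp : (p : Mat n A) * p = p) : affTMap φ (matTrace p) ∈ K0Image B :=
  (affTMap_matTrace φ p).symm ▸ matTrace_mem _ (saMap_mul_self _ p hp)

lemma K0Image_le_comap (φ : A →⋆ₙₐ[ℂ] B) : (K0Image A).topologicalClosure
    ≤ (K0Image B).topologicalClosure.comap (affTMap φ) := by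
  have h : K0Image A ≤ (K0Image B).comap (affTMap φ) := by
    rw [K0Image, AddSubgroup.closure_le]
    rintro _ ⟨n, p, hp, rfl⟩
    exact affTMap_matTrace_mem φ p hp
  intro x hx
  have h1 : affTMap φ x ∈ closure (K0Image B : Set (AffT B)) :=
    map_mem_closure (continuous_affTMap φ) hx h
  exact h1

/-- The map `H(φ) : H(A) → H(B)`, `[h] ↦ [φ(h)]`. -/
def HMap (φ : A →⋆ₙₐ[ℂ] B) : H A →+ H B :=
  QuotientAddGroup.map _ _ (affTMap φ) (K0Image_le_comap φ)

end HGroup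

section Diagonalisable

variable (A : Type*) [CStarAlgebra A]

variable {A} in
/-- `c` is a Nielsen–Thomsen basis: a family `c_k ∈ U^∞(A)`, `k ∈ K_1(A)`, with `c_0 = 1` such that
`k ↦ \overline{c_k}` is a group morphism and a section of `π`. -/
structure IsNTBasis (c : K1 A → UInf A) : Prop where
  class_add : ∀ k l, barClass (c (k + l)) = barClass (c k) + barClass (c l)
  pi_class : ∀ k, piHom A (barClass (c k)) = k
  c_zero : c 0 = 1

variable {A} {B : Type*} [CStarAlgebra B]

/-- `ν : U^∞(A) / \overline{DU^∞(A)} ≃ H(A) ⊕ K_1(A)` is the isomorphism induced by the basis `c`,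
i.e. `ν(\overline{u}) = (x, [u])` where `x` is the determinant of `diag(u, c_{[u]}⋆)`, in other
words `i(x)` is the class of `u c_{[u]}⋆`. -/
def Induces (c : K1 A → UInf A) (ν : K1Bar A ≃+ H A × K1 A) : Prop :=
  ∀ u : UInf A, iHom A (ν (barClass u)).1 = barClass (u * (c (k1Class u))⁻¹) ∧
    (ν (barClass u)).2 = k1Class u

/-- The matrix of `β` with respect to `ν_A` and `ν_B`, as a morphism
`H(A) ⊕ K_1(A) → H(B) ⊕ K_1(B)`. -/
def matrixOf (νA : K1Bar A ≃+ H A × K1 A) (νB : K1Bar B ≃+ H B × K1 B)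
    (β : K1Bar A →+ K1Bar B) : H A × K1 A →+ H B × K1 B :=
  νB.toAddMonoidHom.comp (β.comp νA.symm.toAddMonoidHom)

/-- A morphism `H(A) ⊕ K_1(A) → H(B) ⊕ K_1(B)` is diagonal if both of its off-diagonal entries
`K_1(A) → H(B)` and `H(A) → K_1(B)` vanish. -/
def IsDiagonalMatrix (M : H A × K1 A →+ H B × K1 B) : Prop :=
  (AddMonoidHom.fst (H B) (K1 B)).comp (M.comp (AddMonoidHom.inr (H A) (K1 A))) = 0 ∧
    (AddMonoidHom.snd (H B) (K1 B)).comp (M.comp (AddMonoidHom.inl (H A) (K1 A))) = 0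

/-- `β` is Nielsen–Thomsen diagonalisable if its matrix in suitable Nielsen–Thomsen bases of `A`
and `B` is diagonal. -/
def IsNTDiagonalisable (β : K1Bar A →+ K1Bar B) : Prop :=
  ∃ (c : K1 A → UInf A) (d : K1 B → UInf B) (νA : K1Bar A ≃+ H A × K1 A)
    (νB : K1Bar B ≃+ H B × K1 B), IsNTBasis c ∧ IsNTBasis d ∧ Induces c νA ∧ Induces d νB ∧
      IsDiagonalMatrix (matrixOf νA νB β)

/-- `s` is a section of `π : U^∞(A) / \overline{DU^∞(A)} → K_1(A)`. -/
def IsSection (s : K1 A →+ K1Bar A) : Prop := (piHom A).comp s = AddMonoidHom.id (K1 A)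

/-- `r` is a retract of `i : H(A) → U^∞(A) / \overline{DU^∞(A)}`. -/
def IsRetract (r : K1Bar A →+ H A) : Prop := r.comp (iHom A) = AddMonoidHom.id (H A)

/-- `ν` splits the Nielsen–Thomsen sequence of `A`: it is an isomorphism from the sequence onto
`0 → H(A) → H(A) ⊕ K_1(A) → K_1(A) → 0` that is the identity on `H(A)` and on `K_1(A)`. -/
def IsSplitting (ν : K1Bar A ≃+ H A × K1 A) : Prop :=
  (∀ h, ν (iHom A h) = (h, 0)) ∧ ∀ x, (ν x).2 = piHom A x

/-- The morphism of Nielsen–Thomsen sequences induced by `φ` is split: for suitable splittings of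
the two sequences, it becomes the morphism `H(φ) ⊕ K_1(φ)` in the middle. -/
def IsSplitMorphism (φ : A →⋆ₙₐ[ℂ] B) : Prop :=
  ∃ (νA : K1Bar A ≃+ H A × K1 A) (νB : K1Bar B ≃+ H B × K1 B),
    IsSplitting νA ∧ IsSplitting νB ∧
      matrixOf νA νB (K1BarMap φ) = (HMap φ).prodMap (K1Map φ)

end Diagonalisable
end

end NielsenThomsen

/-! The equivalences are linear algebra over a short exact sequence of abelian groups. A section of
`piHom` and a retract of `iHom` are two descriptions of the same splitting, and Nielsen–Thomsen
bases are lifts of sections to unitaries. If `sB` is the section complementary to `rB`, then `rB`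
kills `β ∘ sA` exactly when `β ∘ sA` takes values in the image of `sB`. The entry `H(A) → K_1(B)`
vanishes exactly when `β` maps the image of `iHom A` into that of `iHom B`, whatever the splittings.
For `β = K1BarMap φ` this is automatic by naturality (`K1BarMap_iHom`), and the other condition
becomes `K1BarMap φ ∘ sA = sB ∘ K1Map φ`.

The substance is exactness of the sequence. In the middle (`exists_iHom_eq`), `U_0^∞` is closed and
consists of products of exponentials, whose classes depend only on the total trace of the exponents.
Injectivity of `iHom` (`iHom_injective`) requires the determinant, which sends `exp(2πih₁) ⋯
exp(2πihₘ)` to `Tr(h₁ + ⋯ + hₘ)`. It must be well defined modulo the image of `K_0`, vanish on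
commutators and have a closed kernel modulo the closure of that image.

Well-definedness (`matTraceHom_sum_mem`) is the part of Bott periodicity saying that the tracial
winding number of a loop of unitaries is an integral combination of traces of projections. The
adjoint of the loop is approximated by a Laurent polynomial `z^{-N} p(z)`. The product of the loop
with this polynomial stays near `1` and so has winding number zero. Hence the winding number of the
loop is `N τ(1)` minus that of `p`, and the latter is the trace of an idempotent built from block
Toeplitz matrices, a Riesz projection of a linear pencil. Idempotents are finally replaced by
projections. Commutators are handled by the Whitehead rotation (`hasDet_commutatorElement`),
closedness by local logarithms (`isClosed_level_detKer`). -/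

namespace NielsenThomsen

noncomputable section

/-! ### Linearising an invertible polynomial: the Toeplitz idempotent and its trace -/

section ToeplitzIdempotent

open Filter Topology

variable {R : Type*} [Ring R]

/-- The `d × d` Toeplitz matrix `(h (m + i - j))`. -/
def toeplitz (d : ℕ) (h : ℤ → R) (m : ℤ) : Matrix (Fin d) (Fin d) R :=
  Matrix.of fun i j => h (m + i - j)

/-- As `l` runs over `2d` consecutive values, `d + i - l` runs over a window of integers that
contains `[0, d]` because `0 ≤ i < d`. This lets a convolution with `f` be cut into two blocks of
length `d`. -/
lemma sum_range_eq_sum_support {M : Type*} [AddCommMonoid M] {d : ℕ} (i : Fin d) (F : ℤ → M)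
    (hF : ∀ p : ℤ, p < 0 ∨ (d : ℤ) < p → F p = 0) :
    ∑ l ∈ Finset.range (d + d), F (d + i - l) = ∑ p ∈ Finset.range (d + 1), F p := by
  refine Finset.sum_bij_ne_zero (fun l _ _ => d + i - l) ?_ ?_ ?_ ?_
  · intro l _ h
    by_contra hc
    refine h (hF _ ?_)
    simp only [Finset.mem_range] at hc
    omega
  · intro l _ h l' _ h' hl
    have h1 : ¬ ((d : ℤ) + i - l < 0) := fun hc => h (hF _ (Or.inl hc))
    have h2 : ¬ ((d : ℤ) + i - l' < 0) := fun hc => h' (hF _ (Or.inl hc))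
    omega
  · intro p hp h
    have := i.2
    simp only [Finset.mem_range] at hp
    have h1 : (d : ℤ) + i - (d + i - p : ℕ) = p := by omega
    exact ⟨d + i - p, by simp only [Finset.mem_range]; omega, by rw [h1]; exact h, by omega⟩
  · intro l _ h
    have h1 : ¬ ((d : ℤ) + i - l < 0) := fun hc => h (hF _ (Or.inl hc))
    congr 1
    omega

/-- Cut into blocks of size `d`, a polynomial of degree at most `d` has only the two blocks `a =
toeplitz d f 0` and `b = toeplitz d f d`, so it becomes the linear pencil `a + bz`. The identity is
the convolution `f * g = δ` read blockwise: the blocks of `g` are the coefficients of a right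
inverse of the pencil. -/
lemma toeplitz_mul_add {d : ℕ} {f g : ℤ → R} (hf : ∀ p : ℤ, p < 0 ∨ (d : ℤ) < p → f p = 0)
    (hfg : ∀ m : ℤ, ∑ p ∈ Finset.range (d + 1), f p * g (m - p) = if m = 0 then 1 else 0) (k : ℤ) :
    toeplitz d f 0 * toeplitz d g (k * d) + toeplitz d f d * toeplitz d g ((k - 1) * d)
      = if k = 0 then 1 else 0 := by
  ext i j
  have h1 := sum_range_eq_sum_support i (fun p => f p * g (k * d + i - j - p))
    fun p hp => by rw [hf p hp, zero_mul]
  rw [hfg, Finset.sum_range_add] at h1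
  rw [Matrix.add_apply, Matrix.mul_apply, Matrix.mul_apply, add_comm]
  simp only [toeplitz, Matrix.of_apply]
  rw [Finset.sum_range, Finset.sum_range] at h1
  have h2 : (if k * d + i - j = 0 then (1 : R) else 0)
      = (if k = 0 then 1 else 0 : Matrix (Fin d) (Fin d) R) i j := by
    have hi := i.2
    have hj := j.2
    by_cases hk : k = 0
    · simp only [hk, if_true, Matrix.one_apply, Fin.ext_iff]
      congr 1
      simp only [eq_iff_iff]
      omega
    · have : k * d + i - j ≠ 0 := by
        rcases lt_or_gt_of_ne hk with h | h <;> nlinarith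
      simp [this, hk]
  rw [← h2, ← h1]
  congr 1 <;> refine Finset.sum_congr rfl fun l _ => ?_
  · congr 2; ring
  · push_cast
    congr 2 <;> ring

lemma toeplitz_mul_add' {d : ℕ} {f g : ℤ → R} (hf : ∀ p : ℤ, p < 0 ∨ (d : ℤ) < p → f p = 0)
    (hgf : ∀ m : ℤ, ∑ p ∈ Finset.range (d + 1), g (m - p) * f p = if m = 0 then 1 else 0) (k : ℤ) :
    toeplitz d g (k * d) * toeplitz d f 0 + toeplitz d g ((k - 1) * d) * toeplitz d f d
      = if k = 0 then 1 else 0 := by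
  ext i j
  have hj := j.2
  -- Now `f` carries the index `l - j` instead of `i - l`. Reversing both the column and the
  -- summation index restores the shape `d + i - l`.
  have h1 := sum_range_eq_sum_support (Fin.rev j) (fun p => g (k * d + i - j - p) * f p)
    fun p hp => by rw [hf p hp, mul_zero]
  rw [hgf, Finset.sum_range_add] at h1
  rw [Matrix.add_apply, Matrix.mul_apply, Matrix.mul_apply, add_comm]
  simp only [toeplitz, Matrix.of_apply]
  rw [Finset.sum_range, Finset.sum_range] at h1
  have h2 : (if k * d + i - j = 0 then (1 : R) else 0)
      = (if k = 0 then 1 else 0 : Matrix (Fin d) (Fin d) R) i j := by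
    have hi := i.2
    by_cases hk : k = 0
    · simp only [hk, if_true, Matrix.one_apply, Fin.ext_iff]
      congr 1
      simp only [eq_iff_iff]
      omega
    · have : k * d + i - j ≠ 0 := by
        rcases lt_or_gt_of_ne hk with h | h <;> nlinarith
      simp [this, hk]
  rw [← h2, ← h1]
  have e : ∀ l : Fin d, ((Fin.rev l : Fin d) : ℤ) = d - 1 - l := fun l => by
    rw [Fin.val_rev]; omega
  congr 1
  · refine Fintype.sum_equiv Fin.revPerm _ _ fun l => ?_
    simp only [Fin.revPerm_apply, e]
    congr 2 <;> ring
  · refine Fintype.sum_equiv Fin.revPerm _ _ fun l => ?_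
    simp only [Fin.revPerm_apply, e]
    push_cast
    simp only [e]
    congr 2 <;> ring

/-- If `f` is a polynomial of degree at most `d` whose inverse has the Fourier coefficients `g`,
then the block Toeplitz matrices of `f` and `g` give an idempotent. -/
lemma toeplitz_idempotent [TopologicalSpace R] [T2Space R] [IsTopologicalRing R] {d : ℕ}
    {f g : ℤ → R} (hf : ∀ p : ℤ, p < 0 ∨ (d : ℤ) < p → f p = 0)
    (hfg : ∀ m : ℤ, ∑ p ∈ Finset.range (d + 1), f p * g (m - p) = if m = 0 then 1 else 0)
    (hgf : ∀ m : ℤ, ∑ p ∈ Finset.range (d + 1), g (m - p) * f p = if m = 0 then 1 else 0)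
    (hg : Tendsto g cofinite (𝓝 0)) :
    (toeplitz d f d * toeplitz d g (-d)) * (toeplitz d f d * toeplitz d g (-d))
      = toeplitz d f d * toeplitz d g (-d) := by
  rcases Nat.eq_zero_or_pos d with rfl | hd
  · ext i; exact i.elim0
  set a := toeplitz d f 0
  set b := toeplitz d f d
  set c : ℤ → Matrix (Fin d) (Fin d) R := fun k => toeplitz d g (k * d) with hc
  have h1 : ∀ k, a * c k + b * c (k - 1) = if k = 0 then 1 else 0 := toeplitz_mul_add hf hfg
  have h2 : ∀ k, c k * a + c (k - 1) * b = if k = 0 then 1 else 0 := toeplitz_mul_add' hf hgf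
  -- Away from index `0` the relations give `a c₋ₖ₋₁ = -b c₋ₖ₋₂` and `cₖ b = -cₖ₊₁ a`, so `cₖ a
  -- c₋ₖ₋₁` does not depend on `k ≥ 0`. Since its outer factors tend to `0`, it vanishes.
  have h3 : ∀ k : ℕ, c 0 * a * c (-1) = c k * a * c (-k - 1) := by
    intro k
    induction k with
    | zero => simp
    | succ k ih =>
      have e1 := h1 (-k - 1)
      have e2 := h2 (k + 1)
      rw [if_neg (by omega), add_eq_zero_iff_eq_neg] at e1 e2
      rw [add_sub_cancel_right] at e2
      push_cast
      rw [ih, mul_assoc, e1, e2, neg_add']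
      simp [mul_assoc]
  have hlim : ∀ φ : ℕ → ℤ, Function.Injective φ → Tendsto (fun k => c (φ k)) atTop (𝓝 0) := by
    intro φ hφ
    refine tendsto_pi_nhds.2 fun i => tendsto_pi_nhds.2 fun j => ?_
    rw [← Nat.cofinite_eq_atTop]
    refine hg.comp (Function.Injective.tendsto_cofinite fun k l hkl => hφ ?_)
    have h : φ k * d = φ l * d := by simpa using hkl
    exact mul_right_cancel₀ (by positivity) h
  have h4 : c 0 * a * c (-1) = 0 := by
    have ha : Tendsto (fun k : ℕ => c k * a * c (-k - 1)) atTop (𝓝 (0 * a * 0)) := by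
      refine Tendsto.mul (Tendsto.mul (hlim _ Nat.cast_injective) tendsto_const_nhds) (hlim _ ?_)
      intro k l hkl
      simpa using hkl
    rw [mul_zero] at ha
    exact tendsto_nhds_unique (tendsto_const_nhds.congr h3) ha
  -- Together with `c₀ a c₋₁ = 0` this gives `c₋₁ b c₋₁ = c₋₁`, hence `b c₋₁` is idempotent.
  have h5 : c (-1) * b = 1 - c 0 * a := by
    have := h2 0
    rw [if_pos rfl, zero_sub] at this
    rw [← this, add_sub_cancel_left]
  have h6 : toeplitz d g (-d) = c (-1) := by simp [hc]
  rw [h6, mul_assoc, ← mul_assoc (c (-1)), h5, sub_mul, one_mul, h4, sub_zero]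

/-- The `i`-th diagonal entry is the sum of `f(p) g(-p)` over `p > i`, so each `p` is counted once
for every `i < p`, that is, `p` times. The factor `p` is what differentiating the polynomial
produces. -/
lemma trace_toeplitz {d : ℕ} {f g : ℤ → R} (hf : ∀ p : ℤ, p < 0 ∨ (d : ℤ) < p → f p = 0) :
    (toeplitz d f d * toeplitz d g (-d)).trace
      = ∑ p ∈ Finset.range (d + 1), p • (f p * g (-p)) := by
  have h1 : ∀ i : Fin d, (toeplitz d f d * toeplitz d g (-d)) i i
      = ∑ p ∈ Finset.range (d + 1), if (i : ℕ) < p then f p * g (-p) else 0 := by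
    intro i
    rw [Matrix.mul_apply]
    have h := sum_range_eq_sum_support i
      (fun p : ℤ => if (i : ℤ) < p then f p * g (-p) else 0) fun p hp => by
        rw [hf p hp, zero_mul, ite_self]
    rw [Finset.sum_range_add] at h
    -- In the second half of the window `p = i - x ≤ i`, so the condition `i < p` fails.
    have h0 : ∑ x ∈ Finset.range d, (if (i : ℤ) < d + i - (d + x : ℕ) then
        f (d + i - (d + x : ℕ)) * g (-(d + i - (d + x : ℕ))) else 0) = 0 := by
      refine Finset.sum_eq_zero fun x hx => if_neg ?_
      push_cast
      omega
    rw [h0, add_zero, Finset.sum_range] at h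
    simp only [Nat.cast_lt] at h
    rw [← h]
    refine Finset.sum_congr rfl fun l _ => ?_
    have := l.2
    rw [if_pos (by omega)]
    simp only [toeplitz, Matrix.of_apply]
    congr 2
    ring
  rw [Matrix.trace]
  simp only [Matrix.diag_apply, h1]
  rw [Finset.sum_comm]
  refine Finset.sum_congr rfl fun p hp => ?_
  rw [← Finset.sum_filter, Finset.sum_const]
  congr 1
  rw [Fin.card_filter_val_lt]
  simp only [Finset.mem_range] at hp
  omega

end ToeplitzIdempotent

/-! ### Vanishing of the tracial winding number near `1` -/

section TracialLoop

open MeasureTheory Filter Topology intervalIntegral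

variable {R T : Type*} [NormedRing R] [NormedAlgebra ℂ R]
  [NormedAddCommGroup T] [NormedSpace ℂ T] (τ : R →L[ℂ] T)

lemma norm_pow_mul_le {R : Type*} [NormedRing R] (x y : R) {r : ℝ} (hx : ‖x‖ ≤ r) (n : ℕ) : ‖x ^ n * y‖ ≤ r ^ n * ‖y‖ := by
  induction n with
  | zero => simp
  | succ n ih =>
    rw [pow_succ', mul_assoc, pow_succ', mul_assoc]
    exact (norm_mul_le _ _).trans (mul_le_mul hx ih (norm_nonneg _) ((norm_nonneg _).trans hx))

variable {τ}

/-- The derivative of a noncommutative power is a sum of terms `x^(n-i) x' x^i`. Under a trace these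
all agree by cyclicity. -/
lemma hasDerivAt_tracial_pow (hτ : ∀ a b, τ (a * b) = τ (b * a)) {x : ℝ → R} {x' : R} {t : ℝ}
    (hx : HasDerivAt x x' t) (n : ℕ) :
    HasDerivAt (fun s => τ (x s ^ (n + 1))) ((n + 1 : ℕ) • τ (x t ^ n * x')) t := by
  have h1 := ((τ.restrictScalars ℝ).hasFDerivAt (x := x t ^ (n + 1))).comp_hasDerivAt t
    (hx.fun_pow' (n + 1))
  refine h1.congr_deriv ?_
  rw [ContinuousLinearMap.coe_restrictScalars', map_sum]
  have h2 : ∀ i ∈ Finset.range (n + 1),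
      τ (x t ^ ((n + 1).pred - i) * x' * x t ^ i) = τ (x t ^ n * x') := fun i hi => by
    rw [hτ, ← mul_assoc, ← pow_add]
    simp only [Finset.mem_range] at hi
    congr 3
    simp only [Nat.pred_succ]
    omega
  rw [Finset.sum_congr rfl h2, Finset.sum_const, Finset.card_range]

variable [CompleteSpace T]

/-- Up to the factor `n + 1`, the integrand is the derivative of `τ(x^(n+1))`, which takes equal
values at the endpoints. These are the terms of the geometric series for `(1 + x)⁻¹ x'`. -/
lemma integral_tracial_pow (hτ : ∀ a b, τ (a * b) = τ (b * a)) {x x' : ℝ → R}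
    (hx : ∀ t, HasDerivAt x (x' t) t) (hx' : Continuous x') (h01 : x 0 = x 1) (n : ℕ) :
    ∫ t in (0 : ℝ)..1, τ (x t ^ n * x' t) = 0 := by
  have hxc : Continuous x := continuous_iff_continuousAt.2 fun t => (hx t).continuousAt
  have h1 : Continuous fun t => (n + 1 : ℕ) • τ (x t ^ n * x' t) :=
    Continuous.const_smul (g := fun t => τ (x t ^ n * x' t))
      (τ.continuous.comp ((hxc.pow n).mul hx')) (n + 1 : ℕ)
  have h2 := integral_eq_sub_of_hasDerivAt
    (fun t _ => hasDerivAt_tracial_pow hτ (hx t) n) (h1.intervalIntegrable 0 1)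
  rw [h01, sub_self] at h2
  simp only [← Nat.cast_smul_eq_nsmul ℂ] at h2
  rw [intervalIntegral.integral_smul, smul_eq_zero] at h2
  exact h2.resolve_left (by exact_mod_cast n.succ_ne_zero)

variable [CompleteSpace R]

/-- A loop in the open unit ball around `1` has vanishing tracial winding number. -/
lemma integral_tracial_inv_eq_zero (hτ : ∀ a b, τ (a * b) = τ (b * a)) {x x' y : ℝ → R}
    (hx : ∀ t, HasDerivAt x (x' t) t) (hx' : Continuous x') (h01 : x 0 = x 1) {r : ℝ} (hr : r < 1)
    (hxr : ∀ t ∈ Set.Icc (0 : ℝ) 1, ‖x t‖ ≤ r) (hy : ∀ t, (1 + x t) * y t = 1) :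
    ∫ t in (0 : ℝ)..1, τ (y t * x' t) = 0 := by
  have hxc : Continuous x := continuous_iff_continuousAt.2 fun t => (hx t).continuousAt
  have hmem : ∀ t ∈ Set.uIoc (0 : ℝ) 1, t ∈ Set.Icc (0 : ℝ) 1 := fun t ht => by
    rw [Set.uIoc_of_le zero_le_one] at ht
    exact ⟨ht.1.le, ht.2⟩
  have hr0 : 0 ≤ r := (norm_nonneg _).trans (hxr 0 ⟨le_rfl, zero_le_one⟩)
  have h1 : HasSum (fun n : ℕ => ∫ t in (0 : ℝ)..1, τ ((-x t) ^ n * x' t))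
      (∫ t in (0 : ℝ)..1, τ (y t * x' t)) := by
    refine hasSum_integral_of_dominated_convergence (fun n t => ‖τ‖ * (r ^ n * ‖x' t‖)) ?_ ?_ ?_ ?_ ?_
    · intro n
      exact (τ.continuous.comp ((hxc.neg.pow n).mul hx')).aestronglyMeasurable
    · refine fun n => Eventually.of_forall fun t ht => (τ.le_opNorm _).trans ?_
      refine mul_le_mul_of_nonneg_left (norm_pow_mul_le _ _ ?_ n) (norm_nonneg _)
      rw [norm_neg]
      exact hxr t (hmem t ht)
    · exact Eventually.of_forall fun t _ =>
        ((summable_geometric_of_lt_one hr0 hr).mul_right _).mul_left _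
    · refine Continuous.intervalIntegrable ?_ _ _
      simp only [tsum_mul_left, tsum_mul_right]
      exact continuous_const.mul (continuous_const.mul hx'.norm)
    · refine Eventually.of_forall fun t ht => ?_
      have hn : ‖-x t‖ < 1 := by
        rw [norm_neg]
        exact (hxr t (hmem t ht)).trans_lt hr
      have hs := summable_geometric_of_norm_lt_one hn
      have hg := geom_series_mul_neg (-x t) hn
      rw [sub_neg_eq_add] at hg
      -- The series is a left inverse of `1 + x t` and `y t` is a right inverse, so they coincide.
      have hyt : ∑' n : ℕ, (-x t) ^ n = y t := by
        rw [← mul_one (∑' n : ℕ, (-x t) ^ n), ← hy t, ← mul_assoc, hg, one_mul]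
      rw [← hyt]
      exact (hs.hasSum.mul_right (x' t)).mapL τ
  have h2 : ∀ n : ℕ, ∫ t in (0 : ℝ)..1, τ ((-x t) ^ n * x' t) = 0 := fun n => by
    have h3 := integral_tracial_pow hτ (x := fun t => -x t) (x' := fun t => -x' t)
      (fun t => (hx t).neg) hx'.neg (by rw [h01]) n
    simpa using h3
  simp only [h2] at h1
  exact h1.unique hasSum_zero

end TracialLoop

/-! ### Fourier coefficients and the winding number of a polynomial -/

section TrigPoly

open MeasureTheory Filter Topology intervalIntegral

/-- The character `t ↦ exp(2πikt)`. -/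
def char (k : ℤ) (t : ℝ) : ℂ := Complex.exp (2 * Real.pi * Complex.I * k * t)

lemma char_add (k l : ℤ) (t : ℝ) : char (k + l) t = char k t * char l t := by
  rw [char, char, char, ← Complex.exp_add]
  congr 1
  push_cast
  ring

lemma char_zero (t : ℝ) : char 0 t = 1 := by simp [char]

lemma hasDerivAt_char (k : ℤ) (t : ℝ) :
    HasDerivAt (char k) ((2 * Real.pi * Complex.I * k) * char k t) t := by
  have h := ((hasDerivAt_id (t : ℂ)).const_mul (2 * Real.pi * Complex.I * k)).cexp.comp_ofReal
  refine h.congr_deriv ?_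
  rw [char, mul_one, mul_comm]
  rfl

lemma continuous_char (k : ℤ) : Continuous (char k) :=
  continuous_iff_continuousAt.2 fun t => (hasDerivAt_char k t).continuousAt

lemma char_int (k : ℤ) (n : ℤ) : char k n = 1 := by
  rw [char, Complex.exp_eq_one_iff]
  exact ⟨k * n, by push_cast; ring⟩

lemma integral_char (k : ℤ) : ∫ t in (0 : ℝ)..1, char k t = if k = 0 then 1 else 0 := by
  split_ifs with h
  · simp [h, char_zero]
  · have h0 : (2 * Real.pi * Complex.I * k : ℂ) ≠ 0 := by
      simp [Real.pi_ne_zero, Complex.I_ne_zero, h]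
    have h1 := integral_eq_sub_of_hasDerivAt (fun t _ => hasDerivAt_char k t)
      (((continuous_char k).const_mul (2 * Real.pi * Complex.I * k)).intervalIntegrable 0 1)
    have h2 := char_int k 0
    have h3 := char_int k 1
    rw [Int.cast_zero] at h2
    rw [Int.cast_one] at h3
    rw [h2, h3, sub_self, intervalIntegral.integral_const_mul, mul_eq_zero] at h1
    exact h1.resolve_left h0

variable {R T : Type*} [NormedRing R] [NormedAlgebra ℂ R]
  [NormedAddCommGroup T] [NormedSpace ℂ T] (τ : R →L[ℂ] T)

/-- The polynomial `∑ exp(2πipt) f(p)`. -/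
def trigPoly (d : ℕ) (f : ℤ → R) (t : ℝ) : R := ∑ p ∈ Finset.range (d + 1), char p t • f p

/-- The derivative of `trigPoly`. -/
def trigPolyDeriv (d : ℕ) (f : ℤ → R) (t : ℝ) : R :=
  ∑ p ∈ Finset.range (d + 1), ((2 * Real.pi * Complex.I * p) * char p t) • f p

lemma hasDerivAt_trigPoly (d : ℕ) (f : ℤ → R) (t : ℝ) :
    HasDerivAt (trigPoly d f) (trigPolyDeriv d f t) t := by
  have h := HasDerivAt.fun_sum (u := Finset.range (d + 1)) (A := fun p s => char p s • f p)
    fun p _ => (hasDerivAt_char p t).smul_const (f p)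
  exact h

lemma continuous_trigPolyDeriv (d : ℕ) (f : ℤ → R) : Continuous (trigPolyDeriv d f) :=
  continuous_finsetSum _ fun p _ => ((continuous_char p).const_mul _).smul continuous_const

/-- The Fourier coefficients of a function on `[0, 1]`. -/
def fourierInt (G : ℝ → R) (k : ℤ) : R := ∫ t in (0 : ℝ)..1, char (-k) t • G t

/-- The Riemann–Lebesgue lemma for the function cut off to `(0, 1]`. This is the decay used in
`toeplitz_idempotent`. -/
lemma tendsto_fourierInt (G : ℝ → R) : Tendsto (fourierInt G) cofinite (𝓝 0) := by
  have h := (Real.tendsto_integral_exp_smul_cocompact ((Set.Ioc (0 : ℝ) 1).indicator G)).comp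
    (Int.tendsto_coe_cofinite)
  refine h.congr fun k => ?_
  rw [fourierInt, integral_of_le zero_le_one, ← MeasureTheory.integral_indicator measurableSet_Ioc]
  refine integral_congr_ae (Eventually.of_forall fun t => ?_)
  simp only [Set.indicator]
  split_ifs
  · rw [Circle.smul_def, Real.fourierChar_apply]
    congr 1
    rw [char]
    congr 1
    push_cast
    ring
  · exact smul_zero _

variable [CompleteSpace R] [CompleteSpace T]

/-- Comparison of the `m`-th Fourier coefficients of the two sides of `trigPoly d f * G = 1`; it
supplies the convolution hypothesis of `toeplitz_idempotent`. -/
lemma sum_mul_fourierInt {d : ℕ} {f : ℤ → R} {G : ℝ → R} (hG : Continuous G)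
    (h : ∀ t, trigPoly d f t * G t = 1) (m : ℤ) :
    ∑ p ∈ Finset.range (d + 1), f p * fourierInt G (m - p) = if m = 0 then 1 else 0 := by
  have hi : ∀ k, IntervalIntegrable (fun t => char k t • G t) volume 0 1 := fun k =>
    ((continuous_char k).smul hG).intervalIntegrable 0 1
  have h1 : ∀ p ∈ Finset.range (d + 1), f p * fourierInt G (m - p)
      = ∫ t in (0 : ℝ)..1, char (-m) t • ((char p t • f p) * G t) := fun p _ => by
    rw [fourierInt]
    refine ((ContinuousLinearMap.mul ℂ R (f p)).intervalIntegral_comp_comm (hi _)).symm.trans ?_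
    refine integral_congr fun t _ => ?_
    simp only [ContinuousLinearMap.mul_apply']
    rw [neg_sub, sub_eq_add_neg, char_add, mul_smul_comm, smul_mul_assoc, smul_smul, mul_comm]
  rw [Finset.sum_congr rfl h1, ← intervalIntegral.integral_finsetSum]
  · have h2 : ∀ t, ∑ p ∈ Finset.range (d + 1), char (-m) t • ((char p t • f p) * G t)
        = char (-m) t • (1 : R) := fun t => by
      rw [← Finset.smul_sum, ← Finset.sum_mul]
      exact congrArg _ (h t)
    simp only [h2]
    rw [intervalIntegral.integral_smul_const, integral_char]
    simp only [neg_eq_zero]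
    split_ifs <;> simp
  · intro p _
    exact ((continuous_char _).smul (((continuous_char _).smul continuous_const).mul
      hG)).intervalIntegrable 0 1

lemma sum_fourierInt_mul {d : ℕ} {f : ℤ → R} {G : ℝ → R} (hG : Continuous G)
    (h : ∀ t, G t * trigPoly d f t = 1) (m : ℤ) :
    ∑ p ∈ Finset.range (d + 1), fourierInt G (m - p) * f p = if m = 0 then 1 else 0 := by
  have hi : ∀ k, IntervalIntegrable (fun t => char k t • G t) volume 0 1 := fun k =>
    ((continuous_char k).smul hG).intervalIntegrable 0 1
  have h1 : ∀ p ∈ Finset.range (d + 1), fourierInt G (m - p) * f p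
      = ∫ t in (0 : ℝ)..1, char (-m) t • (G t * (char p t • f p)) := fun p _ => by
    rw [fourierInt]
    refine (((ContinuousLinearMap.mul ℂ R).flip (f p)).intervalIntegral_comp_comm
      (hi _)).symm.trans ?_
    refine integral_congr fun t _ => ?_
    simp only [ContinuousLinearMap.flip_apply, ContinuousLinearMap.mul_apply']
    rw [neg_sub, sub_eq_add_neg, char_add, mul_smul_comm, smul_mul_assoc, smul_smul, mul_comm]
  rw [Finset.sum_congr rfl h1, ← intervalIntegral.integral_finsetSum]
  · have h2 : ∀ t, ∑ p ∈ Finset.range (d + 1), char (-m) t • (G t * (char p t • f p))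
        = char (-m) t • (1 : R) := fun t => by
      rw [← Finset.smul_sum, ← Finset.mul_sum]
      exact congrArg _ (h t)
    simp only [h2]
    rw [intervalIntegral.integral_smul_const, integral_char]
    simp only [neg_eq_zero]
    split_ifs <;> simp
  · intro p _
    exact ((continuous_char _).smul (hG.mul ((continuous_char _).smul
      continuous_const))).intervalIntegrable 0 1

/-- Differentiation multiplies the `p`-th coefficient by `2πip`, which yields the same weighted sum
as in `trace_toeplitz`. This is how the winding number becomes a trace. -/
lemma integral_trigPolyDeriv_mul (d : ℕ) (f : ℤ → R) {G : ℝ → R} (hG : Continuous G) :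
    ∫ t in (0 : ℝ)..1, trigPolyDeriv d f t * G t = (2 * Real.pi * Complex.I) •
      ∑ p ∈ Finset.range (d + 1), p • (f p * fourierInt G (-p)) := by
  have hi : ∀ k, IntervalIntegrable (fun t => char k t • G t) volume 0 1 := fun k =>
    ((continuous_char k).smul hG).intervalIntegrable 0 1
  simp only [trigPolyDeriv, Finset.sum_mul]
  rw [intervalIntegral.integral_finsetSum, Finset.smul_sum]
  · refine Finset.sum_congr rfl fun p _ => ?_
    have h := (ContinuousLinearMap.mul ℂ R (f p)).intervalIntegral_comp_comm (hi p)
    simp only [ContinuousLinearMap.mul_apply'] at h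
    rw [fourierInt, neg_neg, ← h, ← Nat.cast_smul_eq_nsmul ℂ, smul_smul,
      ← intervalIntegral.integral_smul]
    refine integral_congr fun t _ => ?_
    rw [mul_smul_comm, smul_mul_assoc, smul_smul]
  · intro p _
    exact ((((continuous_char _).const_mul _).smul continuous_const).mul hG).intervalIntegrable 0 1

/-- The tracial winding number of an invertible polynomial on the circle is the trace of an
idempotent. -/
lemma exists_idempotent_of_trigPoly {d : ℕ} {f : ℤ → R}
    (hf : ∀ p : ℤ, p < 0 ∨ (d : ℤ) < p → f p = 0) {G : ℝ → R} (hG : Continuous G)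
    (h1 : ∀ t, trigPoly d f t * G t = 1) (h2 : ∀ t, G t * trigPoly d f t = 1) :
    ∃ P : Matrix (Fin d) (Fin d) R, P * P = P ∧
      ∫ t in (0 : ℝ)..1, τ (trigPolyDeriv d f t * G t)
        = (2 * Real.pi * Complex.I) • τ P.trace := by
  refine ⟨_, toeplitz_idempotent hf (sum_mul_fourierInt hG h1) (sum_fourierInt_mul hG h2)
    (tendsto_fourierInt G), ?_⟩
  rw [trace_toeplitz hf, ← map_smul, ← integral_trigPolyDeriv_mul d f hG]
  exact τ.intervalIntegral_comp_comm
    (((continuous_trigPolyDeriv d f).mul hG).intervalIntegrable 0 1)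

end TrigPoly

/-! ### Uniform approximation of loops by Laurent polynomials -/

section Approximation

open Filter Topology

/-- A partition of unity subordinate to the preimages of `ε`-balls makes `F y` close to a convex
combination of finitely many values of `F`. This reduces vector-valued approximation to scalar
functions times fixed vectors. -/
lemma exists_sum_smul_approx {X E : Type*} [TopologicalSpace X] [CompactSpace X] [T2Space X]
    [NormedAddCommGroup E] [NormedSpace ℂ E] (F : C(X, E)) {ε : ℝ} (hε : 0 < ε) :
    ∃ (s : Finset X) (φ : s → C(X, ℂ)), ∀ y, ‖F y - ∑ x, φ x y • F x‖ ≤ ε := by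
  obtain ⟨s, -, hs⟩ := isCompact_univ.elim_nhds_subcover
    (fun x => F ⁻¹' Metric.ball (F x) ε)
    fun x _ => F.continuous.continuousAt.preimage_mem_nhds (Metric.ball_mem_nhds _ hε)
  obtain ⟨φ, hφ⟩ := PartitionOfUnity.exists_isSubordinate isClosed_univ
    (fun x : s => F ⁻¹' Metric.ball (F x) ε)
    (fun x => Metric.isOpen_ball.preimage F.continuous) (fun y hy => by
      obtain ⟨x, hx, hxy⟩ := Set.mem_iUnion₂.1 (hs hy)
      exact Set.mem_iUnion.2 ⟨⟨x, hx⟩, hxy⟩)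
  refine ⟨s, fun x => ⟨fun y => (φ x y : ℂ), by fun_prop⟩, fun y => ?_⟩
  have h1 : ∑ x, φ x y = 1 := by
    rw [← finsum_eq_sum_of_fintype]
    exact φ.sum_eq_one (Set.mem_univ y)
  have h2 : F y - ∑ x, (φ x y : ℂ) • F x = ∑ x, (φ x y : ℂ) • (F y - F x) := by
    simp only [smul_sub, Finset.sum_sub_distrib, ← Finset.sum_smul]
    rw [← Complex.ofReal_sum, h1, Complex.ofReal_one, one_smul]
  change ‖F y - ∑ x, (φ x y : ℂ) • F x‖ ≤ ε
  rw [h2]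
  refine (norm_sum_le _ _).trans ?_
  calc ∑ x, ‖(φ x y : ℂ) • (F y - F x)‖ ≤ ∑ x, φ x y * ε := by
        refine Finset.sum_le_sum fun x _ => ?_
        rw [norm_smul, Complex.norm_real, Real.norm_of_nonneg (φ.nonneg x y)]
        by_cases h0 : φ x y = 0
        · simp [h0]
        · refine mul_le_mul_of_nonneg_left ?_ (φ.nonneg x y)
          have := hφ x (subset_closure (Function.mem_support.2 h0))
          rw [← dist_eq_norm]
          exact (Metric.mem_ball.1 this).le
    _ = ε := by rw [← Finset.sum_mul, h1, one_mul]

variable {R : Type*} [NormedRing R] [NormedAlgebra ℂ R]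

/-- The Laurent polynomials with coefficients in `R` as functions on the circle. -/
def laurentMap (R : Type*) [NormedRing R] [NormedAlgebra ℂ R] :
    (ℤ →₀ R) →ₗ[ℂ] C(UnitAddCircle, R) :=
  Finsupp.lsum ℂ fun k =>
    { toFun := fun r => ⟨fun x => fourier k x • r, by fun_prop⟩
      map_add' := fun r s => by ext; simp
      map_smul' := fun c r => by ext; simp [smul_comm c] }

lemma laurentMap_apply (a : ℤ →₀ R) (t : ℝ) :
    laurentMap R a (t : UnitAddCircle) = ∑ k ∈ a.support, char k t • a k := by
  rw [laurentMap, Finsupp.lsum_apply, Finsupp.sum, ContinuousMap.sum_apply]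
  refine Finset.sum_congr rfl fun k _ => ?_
  simp only [LinearMap.coe_mk, AddHom.coe_mk, ContinuousMap.coe_mk, char]
  simp

/-- For fixed `r`, the map `g ↦ g • r` is bounded and sends characters to Laurent monomials, so
density of the scalar characters carries over. -/
lemma smul_const_mem_closure (g : C(UnitAddCircle, ℂ)) (r : R) :
    (⟨fun x => g x • r, by fun_prop⟩ : C(UnitAddCircle, R))
      ∈ (LinearMap.range (laurentMap R)).topologicalClosure := by
  let Λ : C(UnitAddCircle, ℂ) →ₗ[ℂ] C(UnitAddCircle, R) :=
    { toFun := fun g => ⟨fun x => g x • r, by fun_prop⟩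
      map_add' := fun g h => by ext; simp [add_smul]
      map_smul' := fun c g => by ext; simp [mul_smul] }
  have hΛ : Continuous Λ := by
    refine AddMonoidHomClass.continuous_of_bound Λ ‖r‖ fun g => ?_
    refine (ContinuousMap.norm_le _ (by positivity)).2 fun x => ?_
    change ‖g x • r‖ ≤ _
    rw [norm_smul, mul_comm]
    exact mul_le_mul_of_nonneg_left (g.norm_coe_le_norm x) (norm_nonneg _)
  have h1 : (Submodule.span ℂ (Set.range (@fourier 1))).topologicalClosure
      ≤ (LinearMap.range (laurentMap R)).topologicalClosure.comap Λ := by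
    refine Submodule.topologicalClosure_minimal _ ?_
      ((Submodule.isClosed_topologicalClosure _).preimage hΛ)
    rw [Submodule.span_le]
    rintro _ ⟨k, rfl⟩
    refine Submodule.le_topologicalClosure _ ⟨Finsupp.single k r, ?_⟩
    rw [laurentMap, Finsupp.lsum_single]
    rfl
  rw [span_fourier_closure_eq_top] at h1
  exact h1 (Submodule.mem_top (x := g))

lemma range_laurentMap_dense : (LinearMap.range (laurentMap R)).topologicalClosure = ⊤ := by
  refine eq_top_iff.2 fun F _ => ?_
  have hcl := Submodule.isClosed_topologicalClosure (LinearMap.range (laurentMap R))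
  rw [← SetLike.mem_coe, ← hcl.closure_eq, Metric.mem_closure_iff]
  intro ε hε
  obtain ⟨s, φ, h⟩ := exists_sum_smul_approx F (half_pos hε)
  refine ⟨∑ x, ⟨fun y => φ x y • F x, by fun_prop⟩,
    Submodule.sum_mem _ fun x _ => smul_const_mem_closure (φ x) (F x), ?_⟩
  refine lt_of_le_of_lt ?_ (half_lt_self hε)
  refine (ContinuousMap.dist_le (half_pos hε).le).2 fun y => ?_
  rw [dist_eq_norm, ContinuousMap.sum_apply]
  exact h y

/-- Continuous loops are uniform limits of Laurent polynomials. -/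
lemma exists_trigPoly_approx {F : ℝ → R} (hF : Continuous F) (h01 : F 0 = F 1) {ε : ℝ}
    (hε : 0 < ε) : ∃ (N d : ℕ) (f : ℤ → R), (∀ p : ℤ, p < 0 ∨ (d : ℤ) < p → f p = 0) ∧
      ∀ t ∈ Set.Icc (0 : ℝ) 1, ‖char (-N) t • trigPoly d f t - F t‖ < ε := by
  have hc : Continuous (AddCircle.liftIco (1 : ℝ) 0 F) :=
    AddCircle.liftIco_continuous (by rw [h01, zero_add]) hF.continuousOn
  have hmem : (⟨_, hc⟩ : C(UnitAddCircle, R)) ∈ (LinearMap.range (laurentMap R)).topologicalClosure := by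
    rw [range_laurentMap_dense]
    exact Submodule.mem_top
  obtain ⟨_, ⟨a, rfl⟩, ha⟩ := Metric.mem_closure_iff.1 hmem ε hε
  -- The sum of all `|k|` in the finite support is a crude common bound. Shifting the frequencies by
  -- `N` then turns the Laurent polynomial into a polynomial of degree at most `2N`.
  obtain ⟨N, hN⟩ : ∃ N : ℕ, ∀ k ∈ a.support, |k| ≤ N := by
    refine ⟨∑ k ∈ a.support, k.natAbs, fun k hk => ?_⟩
    rw [Int.abs_eq_natAbs]
    exact_mod_cast Finset.single_le_sum (f := Int.natAbs) (fun _ _ => Nat.zero_le _) hk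
  have ha0 : ∀ k : ℤ, (N : ℤ) < |k| → a k = 0 := fun k hk => by
    by_contra h
    exact absurd (hN k (Finsupp.mem_support_iff.2 h)) (not_le.2 hk)
  refine ⟨N, 2 * N, fun p => a (p - N), fun p hp => ha0 _ ?_, fun t ht => ?_⟩
  · push_cast at hp
    rcases hp with hp | hp
    · exact lt_abs.2 (Or.inr (by omega))
    · exact lt_abs.2 (Or.inl (by omega))
  have h1 : char (-N) t • trigPoly (2 * N) (fun p => a (p - N)) t
      = laurentMap R a (t : UnitAddCircle) := by
    rw [laurentMap_apply, trigPoly, Finset.smul_sum]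
    simp only [smul_smul, ← char_add]
    refine Finset.sum_bij_ne_zero (fun p _ _ => (p : ℤ) - N) ?_ ?_ ?_ ?_
    · intro p _ h
      refine Finsupp.mem_support_iff.2 fun h0 => h ?_
      rw [h0, smul_zero]
    · intro p _ _ q _ _ h
      omega
    · intro k hk h
      have h2 := abs_le.1 (hN k hk)
      have h3 : ((k + N).toNat : ℤ) = k + N := Int.toNat_of_nonneg (by omega)
      refine ⟨(k + N).toNat, by rw [Finset.mem_range]; omega, ?_, by omega⟩
      rw [h3]
      simpa using h
    · intro p _ _
      congr 2
      ring
  -- `liftIco` reads `F` on `[0, 1)` only, so the endpoint `t = 1` needs `F 0 = F 1`.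
  have h2 : AddCircle.liftIco (1 : ℝ) 0 F (t : UnitAddCircle) = F t := by
    rcases ht.2.lt_or_eq with h | rfl
    · exact AddCircle.liftIco_coe_apply ⟨ht.1, by rwa [zero_add]⟩
    · have : ((1 : ℝ) : UnitAddCircle) = ((0 : ℝ) : UnitAddCircle) := by
        simp
      rw [this, AddCircle.liftIco_coe_apply ⟨le_rfl, by norm_num⟩, h01]
  rw [h1, ← h2, norm_sub_rev, ← dist_eq_norm]
  exact (ContinuousMap.dist_apply_le_dist _).trans_lt ha

end Approximation

/-! ### The winding number of a product of exponentials -/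

section Winding

open selfAdjoint intervalIntegral

variable {R T : Type*} [CStarAlgebra R] [NormedAddCommGroup T] [NormedSpace ℂ T]

/-- The path `t ↦ exp(2πith₁) ⋯ exp(2πithₘ)`. -/
def expPath (l : List (selfAdjoint R)) (t : ℝ) : unitary R :=
  (l.map fun h => expUnitary ((2 * Real.pi * t) • h)).prod

lemma hasDerivAt_expUnitary (h : selfAdjoint R) (t : ℝ) :
    HasDerivAt (fun s : ℝ => ((expUnitary ((2 * Real.pi * s) • h) : unitary R) : R))
      ((expUnitary ((2 * Real.pi * t) • h) : unitary R) *
        (2 * Real.pi * Complex.I : ℂ) • (h : R)) t := by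
  have h1 := hasDerivAt_exp_smul_const (𝕂 := ℝ) ((2 * Real.pi * Complex.I : ℂ) • (h : R)) t
  have h2 : ∀ s : ℝ, ((expUnitary ((2 * Real.pi * s) • h) : unitary R) : R)
      = NormedSpace.exp (s • ((2 * Real.pi * Complex.I : ℂ) • (h : R))) := fun s => by
    rw [expUnitary_coe, selfAdjoint.val_smul, ← Complex.coe_smul, ← Complex.coe_smul, smul_smul,
      smul_smul]
    congr 2
    push_cast
    ring
  simpa only [h2] using h1

/-- By the product rule, the logarithmic derivative is a sum of conjugates of the `2πi hⱼ`. A trace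
does not see the conjugations, so the traced logarithmic derivative is constant in `t`. -/
lemma exists_deriv_expPath {τ : R →L[ℂ] T} (hτ : ∀ a b, τ (a * b) = τ (b * a))
    (l : List (selfAdjoint R)) : ∃ X : ℝ → R, Continuous X ∧ ∀ t,
      HasDerivAt (fun s => (expPath l s : R)) (X t) t ∧
      τ (star (expPath l t : R) * X t)
        = (2 * Real.pi * Complex.I : ℂ) • τ (l.sum : selfAdjoint R) := by
  induction l with
  | nil =>
    refine ⟨fun _ => 0, continuous_const, fun t => ⟨?_, by simp⟩⟩
    simpa [expPath] using hasDerivAt_const t (1 : R)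
  | cons h l ih =>
    obtain ⟨X, hX, hl⟩ := ih
    have hexp := hasDerivAt_expUnitary h
    set e : ℝ → unitary R := fun s => expUnitary ((2 * Real.pi * s) • h) with he
    have hec : Continuous fun s => (e s : R) :=
      continuous_iff_continuousAt.2 fun t => (hexp t).continuousAt
    have hlc : Continuous fun s => (expPath l s : R) :=
      continuous_iff_continuousAt.2 fun t => (hl t).1.continuousAt
    have hcons : ∀ s, (expPath (h :: l) s : R) = e s * expPath l s := fun s => by
      simp [expPath, he]
    refine ⟨fun t => (e t * (2 * Real.pi * Complex.I : ℂ) • (h : R)) * expPath l t + e t * X t,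
      by fun_prop, fun t => ⟨?_, ?_⟩⟩
    · simp only [hcons]
      exact (hexp t).mul (hl t).1
    · have h1 : star (e t : R) * e t = 1 := Unitary.coe_star_mul_self _
      have h2 : (expPath l t : R) * star (expPath l t : R) = 1 := Unitary.coe_mul_star_self _
      have h3 : star (expPath (h :: l) t : R) *
          ((e t * (2 * Real.pi * Complex.I : ℂ) • (h : R)) * expPath l t + e t * X t)
          = star (expPath l t : R) * ((2 * Real.pi * Complex.I : ℂ) • (h : R) * expPath l t)
            + star (expPath l t : R) * X t := by
        rw [hcons, star_mul]
        calc _ = star (expPath l t : R) * (star (e t : R) * e t) *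
              ((2 * Real.pi * Complex.I : ℂ) • (h : R)) * expPath l t
              + star (expPath l t : R) * (star (e t : R) * e t) * X t := by
                noncomm_ring
          _ = _ := by rw [h1]; noncomm_ring
      rw [h3, map_add, hτ, mul_assoc, h2, mul_one, (hl t).2, map_smul, List.sum_cons,
        AddSubgroup.coe_add, map_add, smul_add]

lemma char_fract (k : ℤ) (t : ℝ) : char k (Int.fract t) = char k t := by
  have h : char k t = char k (Int.fract t) * char k (⌊t⌋ : ℤ) := by
    rw [char, char, char, ← Complex.exp_add]
    congr 1
    rw [← mul_add]
    congr 1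
    exact_mod_cast (Int.fract_add_floor t).symm
  rw [h, char_int, mul_one]

/-- The approximation is controlled only on `[0, 1]`, whereas invertibility of the polynomial is
wanted at every real `t`; periodicity bridges the two. -/
lemma trigPoly_fract (d : ℕ) (f : ℤ → R) (t : ℝ) :
    trigPoly d f (Int.fract t) = trigPoly d f t := by
  simp only [trigPoly, char_fract]

variable [CompleteSpace T]

/-- If `exp(2πih₁) ⋯ exp(2πihₘ) = 1`, then `τ(h₁ + ⋯ + hₘ)` is an integral combination of traces of
idempotents, for every tracial `τ`. -/
lemma exists_idempotent_of_prod_eq_one {τ : R →L[ℂ] T} (hτ : ∀ a b, τ (a * b) = τ (b * a))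
    (l : List (selfAdjoint R)) (hl : (l.map fun h => expUnitary ((2 * Real.pi) • h)).prod = 1) :
    ∃ (N d : ℕ) (P : Matrix (Fin d) (Fin d) R), P * P = P ∧
      τ (l.sum : selfAdjoint R) = N • τ 1 - τ P.trace := by
  obtain ⟨X, hX, hder⟩ := exists_deriv_expPath hτ l
  set ξ : ℝ → R := fun t => (expPath l t : R)
  have hξc : Continuous ξ := continuous_iff_continuousAt.2 fun t => (hder t).1.continuousAt
  have h0 : ξ 0 = 1 := by simp [ξ, expPath]
  have h1 : ξ 1 = 1 := by
    simp only [ξ, expPath, mul_one, hl, OneMemClass.coe_one]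
  have hsm : ∀ t, star (ξ t) * ξ t = 1 := fun t => Unitary.coe_star_mul_self _
  have hms : ∀ t, ξ t * star (ξ t) = 1 := fun t => Unitary.coe_mul_star_self _
  -- It is the adjoint loop that is approximated, within `1/2`, so that multiplying by the unitary
  -- `ξ t` makes `z^{-N} ξ p` lie within `1/2` of `1`.
  obtain ⟨N, d, f, hf, happ⟩ := exists_trigPoly_approx (F := fun t => star (ξ t)) hξc.star
    (by simp only [h0, h1]) one_half_pos
  set p := trigPoly d f
  set p' := trigPolyDeriv d f
  have hpd : ∀ t, HasDerivAt p (p' t) t := hasDerivAt_trigPoly d f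
  have hpc : Continuous p := continuous_iff_continuousAt.2 fun t => (hpd t).continuousAt
  have hchar : ∀ t, char N t * char (-N) t = 1 := fun t => by
    rw [← char_add, add_neg_cancel, char_zero]
  have hx : ∀ t ∈ Set.Icc (0 : ℝ) 1, ‖char (-N) t • (ξ t * p t) - 1‖ ≤ 1 / 2 := fun t ht => by
    have h2 : char (-N) t • (ξ t * p t) - 1 = ξ t * (char (-N) t • p t - star (ξ t)) := by
      rw [mul_sub, hms, mul_smul_comm]
    rw [h2, CStarRing.norm_coe_unitary_mul]
    exact (happ t ht).le
  have hpu : ∀ t, IsUnit (p t) := fun t => by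
    change IsUnit (trigPoly d f t)
    rw [← trigPoly_fract]
    have ht : Int.fract t ∈ Set.Icc (0 : ℝ) 1 := ⟨Int.fract_nonneg t, (Int.fract_lt_one t).le⟩
    generalize Int.fract t = t at ht
    have h2 : IsUnit (char (-N) t • (ξ t * p t)) := by
      have h3 := isUnit_one_sub_of_norm_lt_one (x := 1 - char (-N) t • (ξ t * p t)) (by
        rw [norm_sub_rev]; linarith [hx t ht])
      rwa [sub_sub_cancel] at h3
    -- `p` is recovered from an element near `1` by multiplying with a unitary and a nonzero scalar,
    -- hence is invertible.
    have h4 : p t = star (ξ t) * (char N t • (char (-N) t • (ξ t * p t))) := by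
      rw [smul_smul, hchar, one_smul, ← mul_assoc, hsm, one_mul]
    change IsUnit (p t)
    rw [h4]
    refine IsUnit.mul ⟨⟨star (ξ t), ξ t, hsm t, hms t⟩, rfl⟩ ?_
    exact h2.smul (Units.mk0 (char N t) (Complex.exp_ne_zero _))
  set G : ℝ → R := fun t => Ring.inverse (p t)
  have hGc : Continuous G := continuous_iff_continuousAt.2 fun t => by
    obtain ⟨u, hu⟩ := hpu t
    exact ContinuousAt.comp (f := p) (by rw [← hu]; exact NormedRing.inverse_continuousAt u)
      hpc.continuousAt
  have hpG : ∀ t, p t * G t = 1 := fun t => Ring.mul_inverse_cancel _ (hpu t)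
  have hGp : ∀ t, G t * p t = 1 := fun t => Ring.inverse_mul_cancel _ (hpu t)
  obtain ⟨P, hP, hint⟩ := exists_idempotent_of_trigPoly τ hf hGc hpG hGp
  refine ⟨N, d, P, hP, ?_⟩
  -- The loop `z^{-N} ξ p` stays in a ball of radius `1/2` about `1`, so its tracial winding number
  -- is zero.
  have hmain := integral_tracial_inv_eq_zero hτ
    (x := fun t => char (-N) t • (ξ t * p t) - 1)
    (x' := fun t => char (-N) t • (X t * p t + ξ t * p' t)
      + ((2 * Real.pi * Complex.I * (-N : ℤ)) * char (-N) t) • (ξ t * p t))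
    (y := fun t => char N t • (G t * star (ξ t)))
    (fun t => ((hasDerivAt_char (-N) t).smul ((hder t).1.mul (hpd t))).sub_const 1)
    (by
      have h2 := continuous_char (-N)
      have h3 := continuous_trigPolyDeriv d f
      fun_prop)
    (by
      have h2 := char_int (-N) 0
      have h3 := char_int (-N) 1
      rw [Int.cast_zero] at h2
      rw [Int.cast_one] at h3
      have h4 : p 0 = p 1 := by
        change trigPoly d f 0 = trigPoly d f 1
        rw [← trigPoly_fract, ← trigPoly_fract d f 1, Int.fract_zero, Int.fract_one]
      simp only [h0, h1, h2, h3, h4]) one_half_lt_one hx (fun t => by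
      rw [add_sub_cancel, smul_mul_smul_comm, mul_comm, hchar, one_smul, mul_assoc,
        ← mul_assoc (p t), hpG, one_mul, hms])
  -- The traced logarithmic derivative of `z^{-N} ξ p` splits into the contributions `-2πi N τ(1)`,
  -- `2πi τ(∑ hⱼ)` and `τ(p' p⁻¹)` of its three factors. Integrated over the loop, only the last is
  -- not constant, and it is the trace of `P`.
  have hpt : ∀ t, τ ((char N t • (G t * star (ξ t))) * (char (-N) t • (X t * p t + ξ t * p' t)
      + ((2 * Real.pi * Complex.I * (-N : ℤ)) * char (-N) t) • (ξ t * p t)))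
      = (2 * Real.pi * Complex.I : ℂ) • (τ (l.sum : selfAdjoint R) - N • τ 1)
        + τ (p' t * G t) := fun t => by
    have h2 : (char N t • (G t * star (ξ t))) * (char (-N) t • (X t * p t + ξ t * p' t)
        + ((2 * Real.pi * Complex.I * (-N : ℤ)) * char (-N) t) • (ξ t * p t))
        = G t * (star (ξ t) * X t * p t) + G t * p' t
          - (2 * Real.pi * Complex.I * N : ℂ) • (1 : R) := by
      rw [mul_add, smul_mul_smul_comm, smul_mul_smul_comm, hchar, one_smul, mul_left_comm, hchar,
        mul_one, mul_add, mul_assoc (G t), mul_assoc (G t), mul_assoc (G t),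
        ← mul_assoc (star (ξ t)) (ξ t), ← mul_assoc (star (ξ t)) (ξ t), hsm, one_mul, one_mul, hGp,
        ← mul_assoc (star (ξ t))]
      push_cast
      rw [mul_neg, neg_smul, ← sub_eq_add_neg]
    rw [h2, map_sub, map_add, hτ (G t), mul_assoc, hpG, mul_one, (hder t).2, hτ (G t), map_smul,
      smul_sub, ← Nat.cast_smul_eq_nsmul ℂ, smul_smul]
    abel
  have hi : IntervalIntegrable (fun t => τ (p' t * G t)) MeasureTheory.volume 0 1 :=
    (τ.continuous.comp ((continuous_trigPolyDeriv d f).mul hGc)).intervalIntegrable 0 1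
  simp only [hpt] at hmain
  rw [intervalIntegral.integral_add intervalIntegrable_const hi, hint,
    intervalIntegral.integral_const, sub_zero, one_smul, ← smul_add, smul_eq_zero] at hmain
  have h5 := hmain.resolve_left (by simp [Real.pi_ne_zero, Complex.I_ne_zero])
  rw [sub_add, sub_eq_zero] at h5
  exact h5

end Winding

/-! ### From idempotents to projections -/

section Projection

variable {R : Type*} [CStarAlgebra R]

/-- Every idempotent of a C⋆-algebra has the same range as some projection. -/
lemma exists_projection_of_idempotent (e : R) (he : e * e = e) :
    ∃ p : selfAdjoint R, (p : R) * p = p ∧ e * p = p ∧ (p : R) * e = e := by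
  -- Kaplansky's trick: `z ≥ 1` is invertible and `z e = e e⋆ e = e z`, so `e e⋆ z⁻¹` is
  -- self-adjoint and acts as the identity on `e`.
  set z : R := 1 + (e - star e) * star (e - star e) with hz
  have he' : star e * star e = star e := by rw [← star_mul, he]
  have hzu : IsUnit z := by
    let _ := CStarAlgebra.spectralOrder R
    have _ := CStarAlgebra.spectralOrderedRing R
    exact CStarAlgebra.isUnit_of_le 1 (le_add_of_nonneg_right (mul_star_self_nonneg _))
  have hze : z * e = e * star e * e := by
    simp only [hz, star_sub, star_star, add_mul, sub_mul, mul_sub, one_mul, mul_assoc, he, he']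
    simp only [← mul_assoc]
    abel
  have hze' : e * z = e * star e * e := by
    simp only [hz, star_sub, star_star, mul_add, sub_mul, mul_sub, mul_one, ← mul_assoc, he, he']
    simp only [mul_assoc]
    abel
  have hzs : star z = z := by simp [hz]
  obtain ⟨u, hu⟩ := hzu
  rw [← hu] at hze hze' hzs
  have hcomm : Commute (u : R) e := hze.trans hze'.symm
  have hcomm' : Commute (u : R) (star e) := by
    have := hcomm.star_star
    rwa [hzs] at this
  have hw : Commute (↑u⁻¹ : R) e := hcomm.units_inv_left
  have hw' : Commute (↑u⁻¹ : R) (star e) := hcomm'.units_inv_left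
  have hws : star (↑u⁻¹ : R) = ↑u⁻¹ := by
    have h1 : star (↑u⁻¹ : R) * (u : R) = 1 := by
      rw [← star_star (u : R), ← star_mul, hzs, Units.mul_inv, star_one]
    exact (Units.inv_eq_of_mul_eq_one_left h1).symm
  have hpe : e * star e * ↑u⁻¹ * e = e := by
    rw [mul_assoc, hw.eq, ← mul_assoc, ← hze', mul_assoc, Units.mul_inv, mul_one]
  refine ⟨⟨e * star e * ↑u⁻¹, ?_⟩, ?_, ?_, hpe⟩
  · rw [selfAdjoint.mem_iff, star_mul, star_mul, star_star, hws, (hw.mul_right hw').eq]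
  · change e * star e * ↑u⁻¹ * (e * star e * ↑u⁻¹) = _
    rw [← mul_assoc, ← mul_assoc, hpe]
  · change e * (e * star e * ↑u⁻¹) = e * star e * ↑u⁻¹
    rw [← mul_assoc, ← mul_assoc, he]

end Projection

/-! ### The universal trace with values in a Banach space -/

section TraceSpace

variable (A : Type*) [CStarAlgebra A]

/-- The closed linear span of the commutators. -/
def commutatorSpan : Submodule ℂ A :=
  (Submodule.span ℂ {x : A | ∃ a b : A, x = a * b - b * a}).topologicalClosure

instance : IsClosed (commutatorSpan A : Set A) := Submodule.isClosed_topologicalClosure _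

variable {A}

lemma smul_mem_addCommutators (c : ℂ) {y : A} (hy : y ∈ addCommutators A) :
    c • y ∈ addCommutators A := by
  induction hy using AddSubgroup.closure_induction with
  | mem y hy =>
    obtain ⟨a, b, rfl⟩ := hy
    rw [smul_sub, ← smul_mul_assoc, ← mul_smul_comm]
    exact sub_mem_addCommutators _ _
  | zero => rw [smul_zero]; exact AddSubgroup.zero_mem _
  | add y z _ _ hy hz => rw [smul_add]; exact AddSubgroup.add_mem _ hy hz
  | neg y _ hy => rw [smul_neg]; exact AddSubgroup.neg_mem _ hy

/-- Since `c(ab - ba) = (ca)b - b(ca)`, the additive group generated by commutators is already a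
complex subspace. Hence the Banach-space quotient, where integrals make sense, detects vanishing of
the algebraic universal trace. -/
lemma commutatorSpan_le {x : A} (hx : x ∈ commutatorSpan A) :
    x ∈ (addCommutators A).topologicalClosure := by
  refine closure_mono (fun y hy => ?_) hx
  induction hy using Submodule.span_induction with
  | mem y hy => exact AddSubgroup.subset_closure hy
  | zero => exact AddSubgroup.zero_mem _
  | add y z _ _ hy hz => exact AddSubgroup.add_mem _ hy hz
  | smul c y _ hy =>
    exact smul_mem_addCommutators c hy

variable (A) in
/-- The diagonal sum of a matrix, as a continuous linear map. -/
def diagSumL (n : ℕ) : Mat n A →L[ℂ] A where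
  toFun x := ∑ i, entries x i i
  map_add' x y := by simp [entries, Finset.sum_add_distrib]
  map_smul' c x := by simp [entries, Finset.smul_sum]
  cont := by
    refine continuous_finsetSum _ fun i _ => ?_
    let f : Mat n A →ₗ[ℂ] A :=
      { toFun := fun x => entries x i i
        map_add' := fun x y => by simp [entries]
        map_smul' := fun c x => by simp [entries] }
    refine AddMonoidHomClass.continuous_of_bound f 1 fun x => ?_
    rw [one_mul]
    let _ := CStarAlgebra.spectralOrder A
    have _ := CStarAlgebra.spectralOrderedRing A
    exact CStarMatrix.norm_entry_le_norm (M := (x : CStarMatrix (Fin n) (Fin n) A))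

lemma diagSumL_apply {n : ℕ} (x : Mat n A) : diagSumL A n x = (entries x).trace := rfl

variable (A) in
/-- The universal trace on matrices, with values in a Banach space. -/
def matTau (n : ℕ) : Mat n A →L[ℂ] A ⧸ commutatorSpan A :=
  (commutatorSpan A).mkQL.comp (diagSumL A n)

/-- The diagonal sum of `xy - yx` is the sum over `i, j` of the commutators of `x i j` and `y j i`.
-/
lemma matTau_mul_comm {n : ℕ} (x y : Mat n A) : matTau A n (x * y) = matTau A n (y * x) := by
  refine (Submodule.Quotient.eq _).2 (Submodule.le_topologicalClosure _ ?_)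
  have h : ∀ x y : Mat n A, diagSumL A n (x * y) = ∑ i, ∑ j, entries x i j * entries y j i :=
    fun x y => by
      simp [diagSumL_apply, entries, Matrix.trace, Matrix.mul_apply]
  change diagSumL A n (x * y) - diagSumL A n (y * x) ∈ _
  rw [h x y, h y x, Finset.sum_comm (f := fun i j => entries y i j * entries x j i)]
  simp only [← Finset.sum_sub_distrib]
  exact Submodule.sum_mem _ fun i _ => Submodule.sum_mem _ fun j _ =>
    Submodule.subset_span ⟨_, _, rfl⟩

variable (A) in
/-- `matTrace` as an additive map. -/
def matTraceHom (n : ℕ) : selfAdjoint (Mat n A) →+ AffT A where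
  toFun := matTrace
  map_zero' := by
    refine congrArg QuotientAddGroup.mk (Subtype.ext ?_)
    simp [diagSum, entries]
  map_add' x y := by
    refine congrArg QuotientAddGroup.mk (Subtype.ext ?_)
    simp [diagSum, entries, Finset.sum_add_distrib]

lemma continuous_matTraceHom (n : ℕ) : Continuous (matTraceHom A n) :=
  (QuotientAddGroup.isQuotientMap_mk (traceZero A)).continuous.comp
    (Continuous.subtype_mk ((diagSumL A n).continuous.comp continuous_subtype_val) _)

lemma mk_eq_zero_of_mkQL_eq_zero {h : selfAdjoint A} (hh : (commutatorSpan A).mkQL (h : A) = 0) :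
    (QuotientAddGroup.mk h : AffT A) = 0 :=
  (QuotientAddGroup.eq_zero_iff h).2 (mem_traceZero.2
    (commutatorSpan_le ((Submodule.Quotient.mk_eq_zero _).1 hh)))

/-- Equalities between traces of self-adjoint matrices may be checked in the Banach space. -/
lemma matTraceHom_eq_zero {n : ℕ} {x : selfAdjoint (Mat n A)} (h : matTau A n x = 0) :
    matTraceHom A n x = 0 :=
  mk_eq_zero_of_mkQL_eq_zero h

lemma matTraceHom_saConj {n : ℕ} (u : unitary (Mat n A)) (h : selfAdjoint (Mat n A)) :
    matTraceHom A n (saConj u h) = matTraceHom A n h := by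
  rw [← sub_eq_zero, ← map_sub]
  refine matTraceHom_eq_zero ?_
  rw [AddSubgroup.coe_sub, map_sub, sub_eq_zero]
  change matTau A n (u * h * star (u : Mat n A)) = _
  rw [matTau_mul_comm, ← mul_assoc, Unitary.coe_star_mul_self, one_mul]

lemma diagSum_corner {n m : ℕ} (g : Fin n ↪ Fin m) (x : selfAdjoint (Mat n A)) :
    diagSum (saMap (corner g) x) = diagSum x := by
  refine Subtype.ext ?_
  change ∑ i, entries (corner g (x : Mat n A)) i i = ∑ i, entries (x : Mat n A) i i
  simp only [← corner_apply_apply g]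
  rw [← Finset.sum_map Finset.univ g fun i => entries (corner g (x : Mat n A)) i i]
  refine (Finset.sum_subset (Finset.subset_univ _) fun i _ hi => ?_).symm
  refine corner_apply_of_notMem _ _ (Or.inl fun h => hi ?_)
  obtain ⟨j, rfl⟩ := h
  exact Finset.mem_map_of_mem _ (Finset.mem_univ j)

lemma matTraceHom_corner {n m : ℕ} (g : Fin n ↪ Fin m) (x : selfAdjoint (Mat n A)) :
    matTraceHom A m (saMap (corner g) x) = matTraceHom A n x :=
  congrArg QuotientAddGroup.mk (diagSum_corner g x)

/-- A matrix of matrices, regarded as a matrix. -/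
def flatten {n d : ℕ} : Matrix (Fin d) (Fin d) (Mat n A) ≃+* Mat (d * n) A :=
  (((matEquiv n A).symm.toRingEquiv.mapMatrix.trans (Matrix.compRingEquiv (Fin d) (Fin n) A)).trans
    (Matrix.reindexAlgEquiv ℂ A finProdFinEquiv).toRingEquiv).trans (matEquiv (d * n) A).toRingEquiv

lemma entries_flatten {n d : ℕ} (P : Matrix (Fin d) (Fin d) (Mat n A)) (i j : Fin (d * n)) :
    entries (flatten P) i j = entries (P (finProdFinEquiv.symm i).1 (finProdFinEquiv.symm j).1)
      (finProdFinEquiv.symm i).2 (finProdFinEquiv.symm j).2 :=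
  congrFun (congrFun (entries_matEquiv _) i) j

lemma matTau_flatten {n d : ℕ} (P : Matrix (Fin d) (Fin d) (Mat n A)) :
    matTau A (d * n) (flatten P) = matTau A n P.trace := by
  refine congrArg (commutatorSpan A).mkQL ?_
  have h : ∀ i, diagSumL A n (P i i) = ∑ k, entries (P i i) k k := fun _ => rfl
  change diagSumL A (d * n) (flatten P) = diagSumL A n P.trace
  rw [Matrix.trace, map_sum]
  simp only [Matrix.diag_apply, h, diagSumL_apply, Matrix.trace, entries_flatten]
  rw [← Fintype.sum_prod_type' fun i k => entries (P i i) k k]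
  exact Equiv.sum_comp finProdFinEquiv.symm fun x => entries (P x.1 x.1) x.2 x.2

/-- Loops of unitaries have their determinant in the image of `K_0`. -/
lemma matTraceHom_sum_mem {n : ℕ} (l : List (selfAdjoint (Mat n A)))
    (hl : (l.map fun h => selfAdjoint.expUnitary ((2 * Real.pi) • h)).prod = 1) :
    matTraceHom A n l.sum ∈ K0Image A := by
  obtain ⟨N, d, P, hP, h⟩ := exists_idempotent_of_prod_eq_one
    (τ := matTau A n) matTau_mul_comm l hl
  -- The idempotent over `M_n(A)` is flattened to one in `M_{dn}(A)`. From `ep = p` and `pe = e`,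
  -- the trace property gives `τ(e) = τ(pe) = τ(ep) = τ(p)`.
  obtain ⟨p, hp, h1, h2⟩ := exists_projection_of_idempotent (flatten P) (by rw [← map_mul, hP])
  have h3 : matTau A n P.trace = matTau A (d * n) p := by
    rw [← matTau_flatten, ← h2, matTau_mul_comm, h1]
  have h4 : matTraceHom A n l.sum = N • matTraceHom A n 1 - matTraceHom A (d * n) p := by
    rw [← sub_eq_zero]
    refine mk_eq_zero_of_mkQL_eq_zero
      (h := diagSum l.sum - (N • diagSum 1 - diagSum p)) ?_
    simp only [AddSubgroup.coe_sub, AddSubgroup.coe_nsmul, map_sub, map_nsmul]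
    rw [sub_eq_zero]
    exact h.trans (by rw [h3]; rfl)
  rw [h4]
  refine AddSubgroup.sub_mem _ (AddSubgroup.nsmul_mem _ ?_ N) (matTrace_mem p hp)
  -- The term `N τ(1)` is also a `K_0` trace, because the unit of `M_n(A)` is a projection.
  exact matTrace_mem 1 (by simp)

end TraceSpace

/-! ### The de la Harpe–Skandalis determinant and injectivity of `iHom` -/

section Determinant

open selfAdjoint Filter Topology

variable {A : Type*} [CStarAlgebra A]

/-- The product `exp(2πih₁) ⋯ exp(2πihₘ)`. -/
def expProd {R : Type*} [CStarAlgebra R] (l : List (selfAdjoint R)) : unitary R :=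
  (l.map fun h => expUnitary ((2 * Real.pi) • h)).prod

/-- `c` is a value of the (multivalued) determinant of `x`: `x` is a product
`exp(2πih₁) ⋯ exp(2πihₘ)` with `c = Tr(h₁ + ⋯ + hₘ)`. -/
def HasDet (x : UInf A) (c : AffT A) : Prop :=
  ∃ (n : ℕ) (l : List (selfAdjoint (Mat n A))), x = toUInf n (expProd l) ∧
    matTraceHom A n l.sum = c

lemma smul_saMap {R S : Type*} [CStarAlgebra R] [CStarAlgebra S] (f : R →⋆ₙₐ[ℂ] S) (r : ℝ)
    (h : selfAdjoint R) : r • saMap f h = saMap f (r • h) := by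
  ext : 1
  rw [coe_saMap, selfAdjoint.val_smul, selfAdjoint.val_smul, coe_saMap, ← Complex.coe_smul,
    ← Complex.coe_smul, map_smul]

lemma expProd_map_saMap {R S : Type*} [CStarAlgebra R] [CStarAlgebra S] (f : R →⋆ₙₐ[ℂ] S)
    (l : List (selfAdjoint R)) : expProd (l.map (saMap f)) = unitaryExtend f (expProd l) := by
  rw [expProd, expProd, map_list_prod, List.map_map, List.map_map]
  congr 2
  funext h
  simp only [Function.comp_apply]
  rw [smul_saMap, expUnitary_saMap]

lemma expProd_append {R : Type*} [CStarAlgebra R] (l k : List (selfAdjoint R)) :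
    expProd (l ++ k) = expProd l * expProd k := by
  rw [expProd, List.map_append, List.prod_append]
  rfl

lemma expProd_map_saConj {R : Type*} [CStarAlgebra R] (u : unitary R) (l : List (selfAdjoint R)) :
    expProd (l.map (saConj u)) = u * expProd l * u⁻¹ := by
  induction l with
  | nil => simp [expProd]
  | cons h l ih =>
    rw [List.map_cons, expProd, List.map_cons, List.prod_cons]
    change _ * expProd (l.map (saConj u)) = _
    rw [ih, expUnitary_conj u ((2 * Real.pi) • h) _ (by simp [saConj])]
    simp [expProd, mul_assoc]

lemma expUnitary_neg {R : Type*} [CStarAlgebra R] (h : selfAdjoint R) :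
    expUnitary (-h) = (expUnitary h)⁻¹ := by
  rw [eq_inv_iff_mul_eq_one]
  have h1 : Commute ((-h : selfAdjoint R) : R) (h : R) := by
    rw [AddSubgroup.coe_neg]
    exact (Commute.refl _).neg_left
  rw [← h1.expUnitary_add, neg_add_cancel, expUnitary_zero]

lemma expProd_inv {R : Type*} [CStarAlgebra R] (l : List (selfAdjoint R)) :
    expProd (l.reverse.map Neg.neg) = (expProd l)⁻¹ := by
  induction l with
  | nil => simp [expProd]
  | cons h l ih =>
    rw [List.reverse_cons, List.map_append, expProd_append, ih]
    simp only [expProd, List.map_cons, List.map_nil, List.prod_cons, List.prod_nil, mul_one,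
      smul_neg, expUnitary_neg, mul_inv_rev]

lemma sum_reverse_map_neg {M : Type*} [AddCommGroup M] (l : List M) :
    (l.reverse.map Neg.neg).sum = -l.sum := by
  rw [List.map_reverse, List.sum_reverse]
  exact (map_list_sum (negAddMonoidHom : M →+ M) l).symm

/-- Stabilisation preserves both the product of exponentials and the trace, so a determinant value
can be realised at every sufficiently high level. This brings several elements to a common matrix
size. -/
lemma HasDet.exists_level {x : UInf A} {c : AffT A} (h : HasDet x c) (N : ℕ) :
    ∃ n, N ≤ n ∧ ∀ m, n ≤ m → ∃ l : List (selfAdjoint (Mat m A)),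
      x = toUInf m (expProd l) ∧ matTraceHom A m l.sum = c := by
  obtain ⟨n, l, rfl, rfl⟩ := h
  refine ⟨max N n, le_max_left _ _, fun m hm => ?_⟩
  have hnm : n ≤ m := (le_max_right _ _).trans hm
  refine ⟨l.map (saMap (corner (Fin.castLEEmb hnm))), ?_, ?_⟩
  · rw [expProd_map_saMap]
    exact (toUInf_stab hnm _).symm
  · rw [← map_list_sum, matTraceHom_corner]

lemma HasDet.mul {x y : UInf A} {c d : AffT A} (hx : HasDet x c) (hy : HasDet y d) :
    HasDet (x * y) (c + d) := by
  obtain ⟨n, -, hn⟩ := hx.exists_level 0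
  obtain ⟨m, hm, hm'⟩ := hy.exists_level n
  obtain ⟨l, rfl, rfl⟩ := hn m hm
  obtain ⟨k, rfl, rfl⟩ := hm' m le_rfl
  exact ⟨m, l ++ k, by rw [expProd_append, map_mul], by rw [List.sum_append, map_add]⟩

lemma HasDet.inv {x : UInf A} {c : AffT A} (hx : HasDet x c) : HasDet x⁻¹ (-c) := by
  obtain ⟨n, l, rfl, rfl⟩ := hx
  exact ⟨n, _, by rw [expProd_inv, map_inv], by rw [sum_reverse_map_neg, map_neg]⟩

lemma HasDet.conj {x : UInf A} {c : AffT A} (hx : HasDet x c) (y : UInf A) :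
    HasDet (y * x * y⁻¹) c := by
  obtain ⟨m, v, rfl⟩ := exists_toUInf y
  obtain ⟨n, hn, hn'⟩ := hx.exists_level m
  obtain ⟨l, rfl, rfl⟩ := hn' n le_rfl
  refine ⟨n, l.map (saConj (stab A m n hn v)), ?_, ?_⟩
  · rw [expProd_map_saConj, map_mul, map_mul, map_inv, toUInf_stab]
  · rw [map_list_sum, map_list_sum, List.map_map]
    congr 2
    funext h
    exact matTraceHom_saConj _ h

lemma exists_stab_eq_one {n : ℕ} {u : unitary (Mat n A)} (h : toUInf n u = 1) :
    ∃ (m : ℕ) (hm : n ≤ m), stab A n m hm u = 1 := by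
  rw [← map_one (toUInf (A := A) n)] at h
  obtain ⟨m, h1, h2, h3⟩ := Quotient.exact h
  exact ⟨m, h1, h3.trans (map_one _)⟩

/-- The determinant is well defined modulo the image of `K_0`. -/
lemma HasDet.mem_K0Image {c : AffT A} (h : HasDet (1 : UInf A) c) : c ∈ K0Image A := by
  obtain ⟨n, l, h1, rfl⟩ := h
  obtain ⟨m, hm, h2⟩ := exists_stab_eq_one h1.symm
  -- Equality with `1` in the direct limit already holds at a finite level `m`. The corner embedding
  -- keeps the trace, so the statement on loops applies there.
  rw [← matTraceHom_corner (Fin.castLEEmb hm), map_list_sum]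
  refine matTraceHom_sum_mem _ ?_
  have h3 := expProd_map_saMap (corner (Fin.castLEEmb hm)) l
  exact h3.trans h2

lemma HasDet.sub_mem {x : UInf A} {c d : AffT A} (h : HasDet x c) (h' : HasDet x d) :
    c - d ∈ K0Image A := by
  have := h.mul h'.inv
  rw [mul_inv_cancel, ← sub_eq_add_neg] at this
  exact this.mem_K0Image

lemma hasDet_expUnitary {n : ℕ} (h : selfAdjoint (Mat n A)) :
    HasDet (toUInf n (expUnitary ((2 * Real.pi) • h))) (matTraceHom A n h) :=
  ⟨n, [h], by simp [expProd], by simp⟩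

/-- The path component of `1` in the unitary group consists of finite products of exponentials; the
factor `(2π)⁻¹` only adjusts the normalisation. -/
lemma exists_expProd_of_joined {R : Type*} [CStarAlgebra R] {u : unitary R} (h : Joined 1 u) :
    ∃ l : List (selfAdjoint R), expProd l = u := by
  obtain ⟨l, hl⟩ := Unitary.mem_pathComponentOne_iff.1 h
  refine ⟨l.map fun h => (2 * Real.pi)⁻¹ • h, ?_⟩
  rw [expProd, List.map_map, ← hl]
  congr 2
  funext h
  simp only [Function.comp_apply, smul_smul]
  rw [mul_inv_cancel₀ (by positivity), one_smul]

lemma exists_hasDet {x : UInf A} (hx : x ∈ U0Inf A) : ∃ c, HasDet x c := by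
  obtain ⟨n, u, hu, rfl⟩ := hx
  obtain ⟨l, rfl⟩ := exists_expProd_of_joined hu
  exact ⟨_, n, l, rfl, rfl⟩

open scoped commutatorElement in
-- The commutator is a conjugate of `x` times `x⁻¹`, and conjugation preserves the determinant.
lemma HasDet.commutator {x : UInf A} {c : AffT A} (h : HasDet x c) (y : UInf A) :
    HasDet ⁅y, x⁆ 0 := by
  have := (h.conj y).mul h.inv
  rwa [add_neg_cancel] at this

lemma flipUnitary_conj_extend (n : ℕ) (v : unitary (Mat n A)) :
    flipUnitary n * unitaryExtend (cornerL n) v * (flipUnitary n)⁻¹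
      = unitaryExtend (cornerR n) v := by
  ext : 1
  rw [← Unitary.star_eq_inv, Submonoid.coe_mul, Submonoid.coe_mul, Unitary.coe_star,
    coe_unitaryExtend, coe_unitaryExtend, mul_add, add_mul, mul_sub, sub_mul, flipUnitary_conj,
    flipUnitary_conj, mul_one, Unitary.mul_star_self_of_mem (flipUnitary (A := A) n).2]

lemma extend_cornerL_comm_cornerR (n : ℕ) (u v : unitary (Mat n A)) :
    unitaryExtend (cornerL n) u * unitaryExtend (cornerR n) v
      = unitaryExtend (cornerR n) v * unitaryExtend (cornerL n) u := by
  ext : 1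
  simp only [Submonoid.coe_mul, coe_unitaryExtend, mul_add, add_mul, mul_sub, sub_mul,
    cornerL_mul_cornerR, cornerR_mul_cornerL, mul_one, one_mul]
  abel

open scoped commutatorElement in
lemma commutatorElement_eq_conj {G : Type*} [Group G] {U V W : G} (h : U * W = W * U) :
    ⁅U, V⁆ = W * ⁅U, W⁻¹ * V⁆ * W⁻¹ := by
  have h1 : W * U * W⁻¹ = U := by rw [← h, mul_inv_cancel_right]
  calc ⁅U, V⁆ = (W * U * W⁻¹) * V * U⁻¹ * V⁻¹ := by rw [h1, commutatorElement_def]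
    _ = W * ⁅U, W⁻¹ * V⁆ * W⁻¹ := by
      rw [commutatorElement_def]
      group

open scoped commutatorElement in
-- Let `W = F V F⁻¹`. As `W` commutes with `U`, the commutator of `U` and `V` is conjugate to that
-- of `U` and `W⁻¹V`. Here `W⁻¹V` is `F` times a conjugate of `F⁻¹`, so it has a determinant even
-- though `U` and `V` need not have one.
lemma HasDet.commutator_of_commute {F U V : UInf A} {f : AffT A} (hf : HasDet F f)
    (h : U * (F * V * F⁻¹) = (F * V * F⁻¹) * U) : HasDet ⁅U, V⁆ 0 := by
  have hX : HasDet ((F * V * F⁻¹)⁻¹ * V) 0 := by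
    have h1 : (F * V * F⁻¹)⁻¹ * V = F * (V⁻¹ * F⁻¹ * V⁻¹⁻¹) := by group
    rw [h1, ← add_neg_cancel f]
    exact hf.mul (hf.inv.conj V⁻¹)
  rw [commutatorElement_eq_conj h]
  exact (hX.commutator U).conj _

open scoped commutatorElement in
-- Whitehead's argument: after doubling the size, the rotation `flipUnitary`, which is connected to
-- `1`, moves `v` to the opposite corner, where it commutes with `u`.
lemma hasDet_commutatorElement (x y : UInf A) : HasDet ⁅x, y⁆ 0 := by
  obtain ⟨n, u, v, rfl, rfl⟩ := exists_toUInf₂ x y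
  obtain ⟨f, hf⟩ := exists_hasDet (x := toUInf (n + n) (flipUnitary (A := A) n))
    ⟨n + n, _, joined_flipUnitary n, rfl⟩
  refine hf.commutator_of_commute ?_
  have h : ∀ w : unitary (Mat n A), toUInf n w = toUInf (n + n) (unitaryExtend (cornerL n) w) :=
    fun w => by rw [← stab_eq_cornerL, toUInf_stab]
  rw [h u, h v, ← map_inv, ← map_mul, ← map_mul, flipUnitary_conj_extend, ← map_mul, ← map_mul,
    extend_cornerL_comm_cornerR]

variable (A) in
/-- The unitaries with vanishing determinant. -/
def detKer : Subgroup (UInf A) where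
  carrier := {x | ∃ c ∈ (K0Image A).topologicalClosure, HasDet x c}
  one_mem' := ⟨0, AddSubgroup.zero_mem _, 0, [], by simp [expProd], by simp⟩
  mul_mem' := fun ⟨_, hc, h⟩ ⟨_, hd, h'⟩ => ⟨_, AddSubgroup.add_mem _ hc hd, h.mul h'⟩
  inv_mem' := fun ⟨_, hc, h⟩ => ⟨_, AddSubgroup.neg_mem _ hc, h.inv⟩

/-- For `v` near `u`, the unitary `v⁻¹u` lies in the ball of radius `2` about `1`, on which the
logarithm is continuous and inverts the exponential. -/
lemma exists_local_log {R : Type*} [CStarAlgebra R] (u : unitary R) :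
    ∃ g : unitary R → selfAdjoint R, ContinuousAt g u ∧ g u = 0 ∧
      ∀ᶠ v in 𝓝 u, v * expUnitary ((2 * Real.pi) • g v) = u := by
  have h1 : ContinuousAt (fun v : unitary R => v⁻¹ * u) u := by fun_prop
  have hone : Unitary.argSelfAdjoint (1 : unitary R) = 0 := by
    have := argSelfAdjoint_expUnitary (x := (0 : selfAdjoint R)) (by simp [Real.pi_pos])
    rwa [expUnitary_zero] at this
  refine ⟨fun v => (2 * Real.pi)⁻¹ • Unitary.argSelfAdjoint (v⁻¹ * u), ?_, by simp [hone], ?_⟩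
  · have h2 : ContinuousAt (Unitary.argSelfAdjoint : unitary R → _) (u⁻¹ * u) := by
      rw [inv_mul_cancel]
      exact Unitary.continuousOn_argSelfAdjoint.continuousAt (Metric.ball_mem_nhds _ two_pos)
    exact ContinuousAt.const_smul
      (ContinuousAt.comp (f := fun v : unitary R => v⁻¹ * u) h2 h1) (2 * Real.pi)⁻¹
  · have h3 : Metric.ball (1 : unitary R) 2 ∈ 𝓝 (u⁻¹ * u) := by
      rw [inv_mul_cancel]
      exact Metric.ball_mem_nhds _ two_pos
    filter_upwards [h1.preimage_mem_nhds h3] with v hv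
    rw [smul_smul, mul_inv_cancel₀ (by positivity), one_smul, expUnitary_argSelfAdjoint,
      mul_inv_cancel_left]
    have h4 := Metric.mem_ball.1 hv
    rwa [Subtype.dist_eq, dist_eq_norm] at h4

/-- For `v` in the set and near `u`, the determinant of `u` differs from one in the closed group by
`Tr(g v)`. All determinants of `u` agree modulo the image of `K_0`, so a fixed one, `a`, satisfies
`a - Tr(g w) ∈ \overline{K_0(A)}` for all such `w`. Letting `w → u` sends `Tr(g w)` to `0` and puts
`a` in the closed group. -/
lemma isClosed_level_detKer (n : ℕ) : IsClosed {u : unitary (Mat n A) | toUInf n u ∈ detKer A} := by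
  refine isClosed_of_closure_subset fun u hu => ?_
  obtain ⟨g, hgc, hgu, hexp⟩ := exists_local_log u
  have hne := mem_closure_iff_nhdsWithin_neBot.1 hu
  change toUInf n u ∈ detKer A
  generalize hC : {u : unitary (Mat n A) | toUInf n u ∈ detKer A} = C at hne
  have hdet : ∀ᶠ v in 𝓝[C] u, ∃ c ∈ (K0Image A).topologicalClosure,
      HasDet (toUInf n u) (c + matTraceHom A n (g v)) := by
    filter_upwards [self_mem_nhdsWithin, hexp.filter_mono nhdsWithin_le_nhds] with v hv hv'
    rw [← hC] at hv
    obtain ⟨c, hc, h⟩ := hv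
    have h1 := h.mul (hasDet_expUnitary (g v))
    rw [← map_mul, hv'] at h1
    exact ⟨c, hc, h1⟩
  obtain ⟨v, c, -, hv⟩ := hdet.exists
  generalize c + matTraceHom A n (g v) = a at hv
  refine ⟨a, ?_, hv⟩
  have hlim : Tendsto (fun w => a - matTraceHom A n (g w)) (𝓝[C] u) (𝓝 a) := by
    have h1 : ContinuousAt (fun w => a - matTraceHom A n (g w)) u :=
      continuousAt_const.sub ((continuous_matTraceHom n).continuousAt.comp hgc)
    have h2 := h1.tendsto.mono_left (nhdsWithin_le_nhds (s := C))
    rwa [hgu, map_zero, sub_zero] at h2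
  refine (AddSubgroup.isClosed_topologicalClosure (K0Image A)).mem_of_tendsto hlim ?_
  filter_upwards [hdet] with w hw
  obtain ⟨d, hd, h⟩ := hw
  have h1 := AddSubgroup.le_topologicalClosure _ (hv.sub_mem h)
  have h2 : a - matTraceHom A n (g w) = (a - (d + matTraceHom A n (g w))) + d := by abel
  rw [h2]
  exact AddSubgroup.add_mem _ h1 hd

lemma isClosed_of_isClosed_level {C : Set (UInf A)} (h : ∀ n, IsClosed (toUInf n ⁻¹' C)) :
    IsClosed C :=
  (isQuotientMap_quotient_mk' (s := DirectLimit.setoid (stab A))).isClosed_preimage.1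
    (isClosed_sigma_iff.2 h)

lemma isClosed_detKer : IsClosed (detKer A : Set (UInf A)) :=
  isClosed_of_isClosed_level isClosed_level_detKer

lemma DBar_le_detKer : DBar A ≤ detKer A := by
  have h : commutator (UInf A) ≤ detKer A := by
    rw [commutator_def, Subgroup.commutator_le]
    exact fun x _ y _ => ⟨0, AddSubgroup.zero_mem _, hasDet_commutatorElement x y⟩
  exact closure_minimal h isClosed_detKer

lemma matTraceHom_toMatOne (h : selfAdjoint A) :
    matTraceHom A 1 (saMap (toMatOne A) h) = QuotientAddGroup.mk h := by
  refine congrArg QuotientAddGroup.mk (Subtype.ext ?_)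
  change ∑ i, entries (toMatOne A (h : A)) i i = h
  simp [toMatOne_apply]

/-- Exactness of the Nielsen–Thomsen sequence at `H(A)`. -/
lemma iHom_injective : Function.Injective (iHom A) := by
  refine (injective_iff_map_eq_zero _).2 fun x hx => ?_
  obtain ⟨y, rfl⟩ := QuotientAddGroup.mk_surjective x
  obtain ⟨h, rfl⟩ := QuotientAddGroup.mk_surjective y
  rw [iHom_mk] at hx
  obtain ⟨c, hc, hdet⟩ := DBar_le_detKer (barHom_eq_one_iff.1 hx)
  -- The same unitary has the determinants `Tr(h)` and `c`, so `Tr(h) - c` lies in the image of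
  -- `K_0`, while `c` lies in its closure.
  have h1 := AddSubgroup.le_topologicalClosure _ ((hasDet_expUnitary _).sub_mem hdet)
  rw [matTraceHom_toMatOne] at h1
  rw [QuotientAddGroup.eq_zero_iff]
  simpa using AddSubgroup.add_mem _ h1 hc

end Determinant

/-! ### Exactness in the middle and naturality -/

section Exactness

open selfAdjoint Topology

variable {A B : Type*} [CStarAlgebra A] [CStarAlgebra B]

/-- A unitary in the closure differs from a nearby element of the subgroup by an exponential, which
is connected to `1`. Hence the kernel of `piHom` consists of genuine products of exponentials,
without limits. -/
lemma isClosed_U0Inf : IsClosed (U0Inf A : Set (UInf A)) := by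
  refine isClosed_of_isClosed_level fun n => isClosed_of_closure_subset fun u hu => ?_
  obtain ⟨g, -, -, hexp⟩ := exists_local_log u
  obtain ⟨v, hv, hv'⟩ := mem_closure_iff_nhds.1 hu _ hexp
  change v * expUnitary _ = u at hv
  change toUInf n u ∈ U0Inf A
  rw [← hv, map_mul]
  exact (U0Inf A).mul_mem hv' ⟨n, _, joined_one_expUnitary _, rfl⟩

lemma U0Bar_eq : U0Bar A = U0Inf A :=
  le_antisymm (closure_minimal subset_rfl isClosed_U0Inf) (le_closureSubgroup _)

lemma k1Class_eq_zero_iff {u : UInf A} : k1Class u = 0 ↔ u ∈ U0Inf A := by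
  rw [← U0Bar_eq]
  exact QuotientGroup.eq_one_iff (N := U0Bar A) u

lemma barClass_surjective : Function.Surjective (barClass (A := A)) :=
  QuotientGroup.mk'_surjective (DBar A)

lemma k1Class_surjective : Function.Surjective (k1Class (A := A)) :=
  QuotientGroup.mk'_surjective (U0Bar A)

lemma piHom_surjective : Function.Surjective (piHom A) := fun k => by
  obtain ⟨u, rfl⟩ := k1Class_surjective k
  exact ⟨barClass u, rfl⟩

lemma barClass_mul (u v : UInf A) : barClass (u * v) = barClass u + barClass v := by
  rw [barClass, map_mul]
  rfl

lemma barClass_one : barClass (1 : UInf A) = 0 := by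
  rw [barClass, map_one]
  rfl

lemma barClass_inv (u : UInf A) : barClass u⁻¹ = -barClass u := by
  rw [barClass, map_inv]
  rfl

lemma piHom_iHom (x : H A) : piHom A (iHom A x) = 0 := by
  obtain ⟨y, rfl⟩ := QuotientAddGroup.mk_surjective x
  obtain ⟨h, rfl⟩ := QuotientAddGroup.mk_surjective y
  rw [iHom_mk, piHom_barClass, k1Class_eq_zero_iff]
  exact ⟨1, _, joined_one_expUnitary _, rfl⟩

lemma barClass_expProd {n : ℕ} (l : List (selfAdjoint (Mat n A))) :
    barClass (toUInf n (expProd l)) = expLevel A n l.sum := by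
  induction l with
  | nil =>
    rw [List.sum_nil, map_zero, ← barClass_one, ← map_one (toUInf (A := A) n)]
    rfl
  | cons h l ih =>
    rw [List.sum_cons, map_add, ← ih, expLevel_apply, ← barClass_mul, ← map_mul]
    rfl

/-- Exactness of the Nielsen–Thomsen sequence in the middle. -/
lemma exists_iHom_eq {x : K1Bar A} (hx : piHom A x = 0) : ∃ y, iHom A y = x := by
  obtain ⟨u, rfl⟩ := barClass_surjective x
  obtain ⟨n, u, hu, rfl⟩ := k1Class_eq_zero_iff.1 hx
  obtain ⟨l, rfl⟩ := exists_expProd_of_joined hu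
  -- The class of a product of exponentials is that of the exponential of the sum, and depends only
  -- on the trace, so it is represented by a self-adjoint element of `A` itself.
  rw [barClass_expProd, expLevel_eq]
  exact ⟨QuotientAddGroup.mk (QuotientAddGroup.mk (diagSum l.sum) : AffT A), rfl⟩

lemma piHom_K1BarMap (φ : A →⋆ₙₐ[ℂ] B) (x : K1Bar A) :
    piHom B (K1BarMap φ x) = K1Map φ (piHom A x) := by
  obtain ⟨u, rfl⟩ := barClass_surjective x
  rfl

lemma K1BarMap_iHom (φ : A →⋆ₙₐ[ℂ] B) (x : H A) :
    K1BarMap φ (iHom A x) = iHom B (HMap φ x) := by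
  obtain ⟨y, rfl⟩ := QuotientAddGroup.mk_surjective x
  obtain ⟨h, rfl⟩ := QuotientAddGroup.mk_surjective y
  have h1 : HMap φ (QuotientAddGroup.mk (QuotientAddGroup.mk h : AffT A))
      = QuotientAddGroup.mk (QuotientAddGroup.mk (saMap φ h) : AffT B) := rfl
  rw [h1, iHom_mk, iHom_mk]
  have h2 : matUnitaryMap φ 1 (expUnitary ((2 * Real.pi) • saMap (toMatOne A) h))
      = expUnitary ((2 * Real.pi) • saMap (toMatOne B) (saMap φ h)) := by
    rw [matUnitaryMap, ← expUnitary_saMap, ← smul_saMap]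
    congr 2
  rw [← h2]
  rfl

end Exactness

/-! ### Sections, retracts, bases and the equivalences -/

section Splitting

variable {A B : Type*} [CStarAlgebra A] [CStarAlgebra B]

lemma IsSection.apply {s : K1 A →+ K1Bar A} (hs : IsSection s) (k : K1 A) : piHom A (s k) = k :=
  DFunLike.congr_fun hs k

lemma IsRetract.apply {r : K1Bar A →+ H A} (hr : IsRetract r) (h : H A) : r (iHom A h) = h :=
  DFunLike.congr_fun hr h

lemma IsSection.bijective {s : K1 A →+ K1Bar A} (hs : IsSection s) :
    Function.Bijective ((iHom A).coprod s) := by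
  have hπ : ∀ x : H A × K1 A, piHom A ((iHom A).coprod s x) = x.2 := fun x => by
    rw [AddMonoidHom.coprod_apply, map_add, piHom_iHom, hs.apply, zero_add]
  refine ⟨(injective_iff_map_eq_zero _).2 fun x hx => ?_, fun x => ?_⟩
  · have h2 : x.2 = 0 := by rw [← hπ, hx, map_zero]
    rw [AddMonoidHom.coprod_apply, h2, map_zero, add_zero] at hx
    exact Prod.ext ((injective_iff_map_eq_zero _).1 iHom_injective _ hx) h2
  · obtain ⟨y, hy⟩ := exists_iHom_eq (x := x - s (piHom A x)) (by
      rw [map_sub, hs.apply, sub_self])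
    exact ⟨(y, piHom A x), by rw [AddMonoidHom.coprod_apply, hy, sub_add_cancel]⟩

/-- The splitting of the Nielsen–Thomsen sequence given by a section. -/
def IsSection.split {s : K1 A →+ K1Bar A} (hs : IsSection s) : K1Bar A ≃+ H A × K1 A :=
  (AddEquiv.ofBijective _ hs.bijective).symm

lemma IsSection.split_symm_apply {s : K1 A →+ K1Bar A} (hs : IsSection s)
    (x : H A × K1 A) : hs.split.symm x = iHom A x.1 + s x.2 := rfl

lemma IsSection.split_add {s : K1 A →+ K1Bar A} (hs : IsSection s)
    (h : H A) (k : K1 A) : hs.split (iHom A h + s k) = (h, k) :=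
  hs.split.apply_symm_apply (h, k)

lemma IsSection.split_section {s : K1 A →+ K1Bar A} (hs : IsSection s)
    (k : K1 A) : hs.split (s k) = (0, k) := by
  have := hs.split_add 0 k
  rwa [map_zero, zero_add] at this

lemma IsSection.isSplitting {s : K1 A →+ K1Bar A} (hs : IsSection s)
    : IsSplitting hs.split := by
  refine ⟨fun h => ?_, fun x => ?_⟩
  · have := hs.split_add h 0
    rwa [map_zero, add_zero] at this
  · obtain ⟨⟨h, k⟩, rfl⟩ := hs.split.symm.surjective x
    rw [AddEquiv.apply_symm_apply, hs.split_symm_apply, map_add, piHom_iHom, hs.apply, zero_add]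

/-- Every retract is the retract of the splitting of some section. -/
lemma IsRetract.exists_section {r : K1Bar A →+ H A} (hr : IsRetract r) :
    ∃ s : K1 A →+ K1Bar A, IsSection s ∧ ∀ x, s (piHom A x) = x - iHom A (r x) := by
  -- The map `x ↦ x - i(r(x))` kills the image of `iHom`, which is the kernel of `piHom`, so it
  -- descends to `K_1(A)`.
  have hker : (piHom A).ker ≤ (AddMonoidHom.id (K1Bar A) - (iHom A).comp r).ker := fun x hx => by
    obtain ⟨y, rfl⟩ := exists_iHom_eq hx
    rw [AddMonoidHom.mem_ker, AddMonoidHom.sub_apply, AddMonoidHom.id_apply,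
      AddMonoidHom.comp_apply, hr.apply, sub_self]
  have happ : ∀ x, (piHom A).liftOfSurjective piHom_surjective ⟨_, hker⟩ (piHom A x)
      = x - iHom A (r x) := fun x =>
    AddMonoidHom.liftOfRightInverse_comp_apply _ _ _ ⟨_, hker⟩ x
  refine ⟨_, AddMonoidHom.ext fun k => ?_, happ⟩
  obtain ⟨x, rfl⟩ := piHom_surjective k
  rw [AddMonoidHom.comp_apply, happ, map_sub, piHom_iHom, sub_zero]
  rfl

lemma IsSection.exists_basis {s : K1 A →+ K1Bar A} (hs : IsSection s)
    : ∃ c : K1 A → UInf A, IsNTBasis c ∧ ∀ k, barClass (c k) = s k := by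
  classical
  obtain ⟨f, hf⟩ := (barClass_surjective (A := A)).hasRightInverse
  -- The value at `0` is forced to be `1` to meet the normalisation of a basis; this agrees with the
  -- section because `s 0 = 0`.
  have hc : ∀ k, barClass (if k = 0 then 1 else f (s k)) = s k := fun k => by
    split_ifs with h
    · rw [h, map_zero, barClass_one]
    · exact hf _
  exact ⟨fun k => if k = 0 then 1 else f (s k),
    ⟨fun k l => by rw [hc, hc, hc, map_add], fun k => by rw [hc, hs.apply], if_pos rfl⟩, hc⟩

lemma IsSection.induces {s : K1 A →+ K1Bar A} (hs : IsSection s)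
    {c : K1 A → UInf A} (hc : ∀ k, barClass (c k) = s k) :
    Induces c hs.split := by
  intro u
  have h2 : (hs.split (barClass u)).2 = k1Class u := hs.isSplitting.2 _
  have h1 := hs.split_symm_apply (hs.split (barClass u))
  rw [AddEquiv.symm_apply_apply, h2] at h1
  refine ⟨?_, h2⟩
  rw [barClass_mul, barClass_inv, hc, ← sub_eq_add_neg]
  exact eq_sub_of_add_eq h1.symm

lemma Induces.isSplitting {c : K1 A → UInf A} {ν : K1Bar A ≃+ H A × K1 A} (h : Induces c ν)
    (hc : IsNTBasis c) : IsSplitting ν := by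
  refine ⟨fun x => ?_, fun x => ?_⟩
  · obtain ⟨u, hu⟩ := barClass_surjective (iHom A x)
    have h0 : k1Class u = 0 := by rw [← piHom_barClass, hu, piHom_iHom]
    obtain ⟨h1, h2⟩ := h u
    -- The normalisation `c 0 = 1` enters here: without it `ν` would shift `iHom` by the class of `c
    -- 0`.
    rw [h0, hc.c_zero, inv_one, mul_one, hu] at h1
    rw [h0, hu] at h2
    exact Prod.ext (iHom_injective h1) h2
  · obtain ⟨u, rfl⟩ := barClass_surjective x
    exact (h u).2

lemma IsSplitting.symm_apply {ν : K1Bar A ≃+ H A × K1 A} (h : IsSplitting ν) (x : H A) :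
    ν.symm (x, 0) = iHom A x := by
  rw [← h.1, AddEquiv.symm_apply_apply]

lemma IsSplitting.isSection {ν : K1Bar A ≃+ H A × K1 A} (h : IsSplitting ν) :
    IsSection (ν.symm.toAddMonoidHom.comp (AddMonoidHom.inr (H A) (K1 A))) := by
  refine AddMonoidHom.ext fun k => ?_
  change piHom A (ν.symm (0, k)) = k
  rw [← h.2, AddEquiv.apply_symm_apply]

lemma IsSplitting.isRetract {ν : K1Bar A ≃+ H A × K1 A} (h : IsSplitting ν) :
    IsRetract ((AddMonoidHom.fst (H A) (K1 A)).comp ν.toAddMonoidHom) := by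
  refine AddMonoidHom.ext fun x => ?_
  change (ν (iHom A x)).1 = x
  rw [h.1]

/-- By exactness in the middle, the entry `H(A) → K_1(B)` vanishes independently of the splittings
exactly under the range condition. Only the entry `K_1(A) → H(B)` depends on them. -/
lemma isDiagonalMatrix_iff {νA : K1Bar A ≃+ H A × K1 A} {νB : K1Bar B ≃+ H B × K1 B}
    (hA : IsSplitting νA) (hB : IsSplitting νB) (β : K1Bar A →+ K1Bar B) :
    IsDiagonalMatrix (matrixOf νA νB β) ↔ (∀ k, (νB (β (νA.symm (0, k)))).1 = 0) ∧
      (β.comp (iHom A)).range ≤ (iHom B).range := by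
  refine and_congr DFunLike.ext_iff (DFunLike.ext_iff.trans ?_)
  constructor
  · rintro h _ ⟨x, rfl⟩
    refine exists_iHom_eq ?_
    have h1 : (νB (β (νA.symm (x, 0)))).2 = 0 := h x
    rwa [hA.symm_apply, hB.2] at h1
  · intro h x
    change (νB (β (νA.symm (x, 0)))).2 = 0
    rw [hA.symm_apply, hB.2]
    obtain ⟨y, hy⟩ := h ⟨x, rfl⟩
    change iHom B y = β (iHom A x) at hy
    rw [← hy, piHom_iHom]

theorem isNTDiagonalisable_iff (β : K1Bar A →+ K1Bar B) : IsNTDiagonalisable β ↔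
    ∃ (sA : K1 A →+ K1Bar A) (rB : K1Bar B →+ H B), IsSection sA ∧ IsRetract rB ∧
      rB.comp (β.comp sA) = 0 ∧ (β.comp (iHom A)).range ≤ (iHom B).range := by
  constructor
  · rintro ⟨c, d, νA, νB, hc, hd, hcA, hdB, hdiag⟩
    have hA := hcA.isSplitting hc
    have hB := hdB.isSplitting hd
    rw [isDiagonalMatrix_iff hA hB] at hdiag
    exact ⟨_, _, hA.isSection, hB.isRetract, AddMonoidHom.ext hdiag.1, hdiag.2⟩
  · rintro ⟨sA, rB, hA, hr, h0, hrange⟩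
    obtain ⟨sB, hB, hsB⟩ := hr.exists_section
    obtain ⟨c, hc, hcs⟩ := hA.exists_basis
    obtain ⟨d, hd, hds⟩ := hB.exists_basis
    refine ⟨c, d, hA.split, hB.split, hc, hd, hA.induces hcs, hB.induces hds, ?_⟩
    rw [isDiagonalMatrix_iff hA.isSplitting hB.isSplitting]
    refine ⟨fun k => ?_, hrange⟩
    have h1 : rB (β (sA k)) = 0 := DFunLike.congr_fun h0 k
    -- An element killed by `rB` lies in the image of the complementary section `sB`, so its
    -- `H(B)`-coordinate in the splitting of `sB` is zero.
    have h2 : sB (piHom B (β (sA k))) = β (sA k) := by rw [hsB, h1, map_zero, sub_zero]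
    rw [hA.split_symm_apply, map_zero, zero_add, ← h2, hB.split_section]

theorem K1BarMap_range_le (φ : A →⋆ₙₐ[ℂ] B) :
    ((K1BarMap φ).comp (iHom A)).range ≤ (iHom B).range := by
  rintro _ ⟨x, rfl⟩
  exact ⟨HMap φ x, (K1BarMap_iHom φ x).symm⟩

/-- Vanishing of `rB` on `K1BarMap φ ∘ sA` means that this map equals `sB ∘ piHom B` applied to
itself, and naturality of `piHom` identifies the result with `sB ∘ K1Map φ`. -/
lemma exists_sections_iff (φ : A →⋆ₙₐ[ℂ] B) :
    (∃ (sA : K1 A →+ K1Bar A) (rB : K1Bar B →+ H B), IsSection sA ∧ IsRetract rB ∧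
      rB.comp ((K1BarMap φ).comp sA) = 0 ∧
        ((K1BarMap φ).comp (iHom A)).range ≤ (iHom B).range) ↔
    ∃ (sA : K1 A →+ K1Bar A) (sB : K1 B →+ K1Bar B), IsSection sA ∧ IsSection sB ∧
      (K1BarMap φ).comp sA = sB.comp (K1Map φ) := by
  constructor
  · rintro ⟨sA, rB, hA, hr, h0, -⟩
    obtain ⟨sB, hB, hsB⟩ := hr.exists_section
    refine ⟨sA, sB, hA, hB, AddMonoidHom.ext fun k => ?_⟩
    have h1 : rB (K1BarMap φ (sA k)) = 0 := DFunLike.congr_fun h0 k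
    have h2 := hsB (K1BarMap φ (sA k))
    rw [h1, map_zero, sub_zero, piHom_K1BarMap, hA.apply] at h2
    exact h2.symm
  · rintro ⟨sA, sB, hA, hB, h⟩
    refine ⟨sA, _, hA, hB.isSplitting.isRetract, ?_, K1BarMap_range_le φ⟩
    refine AddMonoidHom.ext fun k => ?_
    rw [h]
    change (hB.split (sB (K1Map φ k))).1 = 0
    rw [hB.split_section]

/-- On the summand `H(A)` the diagonal form is automatic by naturality of `iHom`, so only
compatibility on the images of the sections matters. -/
lemma isSplitMorphism_iff (φ : A →⋆ₙₐ[ℂ] B) : IsSplitMorphism φ ↔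
    ∃ (sA : K1 A →+ K1Bar A) (sB : K1 B →+ K1Bar B), IsSection sA ∧ IsSection sB ∧
      (K1BarMap φ).comp sA = sB.comp (K1Map φ) := by
  constructor
  · rintro ⟨νA, νB, hA, hB, h⟩
    refine ⟨_, _, hA.isSection, hB.isSection, AddMonoidHom.ext fun k => νB.injective ?_⟩
    have h1 : νB (K1BarMap φ (νA.symm (0, k))) = (HMap φ 0, K1Map φ k) :=
      DFunLike.congr_fun h (0, k)
    rw [map_zero] at h1
    exact h1.trans (νB.apply_symm_apply (0, K1Map φ k)).symm
  · rintro ⟨sA, sB, hA, hB, h⟩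
    refine ⟨hA.split, hB.split, hA.isSplitting, hB.isSplitting, AddMonoidHom.ext fun x => ?_⟩
    have h1 : K1BarMap φ (sA x.2) = sB (K1Map φ x.2) := DFunLike.congr_fun h x.2
    change hB.split (K1BarMap φ (hA.split.symm x)) = (HMap φ x.1, K1Map φ x.2)
    rw [hA.split_symm_apply, map_add, K1BarMap_iHom, h1, hB.split_add]

end Splitting

end

end NielsenThomsen

theorem mainTheorem11 {A : Type*} {B : Type*} [CStarAlgebra A] [CStarAlgebra B] :
    (∀ β : NielsenThomsen.K1Bar A →+ NielsenThomsen.K1Bar B,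
      NielsenThomsen.IsNTDiagonalisable β ↔
        ∃ (sA : NielsenThomsen.K1 A →+ NielsenThomsen.K1Bar A)
          (rB : NielsenThomsen.K1Bar B →+ NielsenThomsen.H B),
          NielsenThomsen.IsSection sA ∧ NielsenThomsen.IsRetract rB ∧
            rB.comp (β.comp sA) = 0 ∧
            (β.comp (NielsenThomsen.iHom A)).range ≤ (NielsenThomsen.iHom B).range) ∧
    (∀ φ : A →⋆ₙₐ[ℂ] B, List.TFAE [
      NielsenThomsen.IsNTDiagonalisable (NielsenThomsen.K1BarMap φ),
      ∃ (sA : NielsenThomsen.K1 A →+ NielsenThomsen.K1Bar A)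
        (rB : NielsenThomsen.K1Bar B →+ NielsenThomsen.H B),
        NielsenThomsen.IsSection sA ∧ NielsenThomsen.IsRetract rB ∧
          rB.comp ((NielsenThomsen.K1BarMap φ).comp sA) = 0 ∧
          ((NielsenThomsen.K1BarMap φ).comp (NielsenThomsen.iHom A)).range
            ≤ (NielsenThomsen.iHom B).range,
      NielsenThomsen.IsSplitMorphism φ,
      ∃ (sA : NielsenThomsen.K1 A →+ NielsenThomsen.K1Bar A)
        (sB : NielsenThomsen.K1 B →+ NielsenThomsen.K1Bar B),
        NielsenThomsen.IsSection sA ∧ NielsenThomsen.IsSection sB ∧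
          (NielsenThomsen.K1BarMap φ).comp sA = sB.comp (NielsenThomsen.K1Map φ)]) := by
  refine ⟨NielsenThomsen.isNTDiagonalisable_iff, fun φ => ?_⟩
  tfae_have 1 ↔ 2 := NielsenThomsen.isNTDiagonalisable_iff _
  tfae_have 2 ↔ 4 := NielsenThomsen.exists_sections_iff φ
  tfae_have 3 ↔ 4 := NielsenThomsen.isSplitMorphism_iff φ
  tfae_finish
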